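/- Let $n\ge 2$, let $k_1,\dots,k_n$ be nonnegative integers, and let $\lambda=\sum_{i=1}^n k_i\lambda_i$, $|\lambda|=\sum_{i=1}^n k_i$. Here the positive root vectors of $sl(n+1)=sl(n+1,\mathbb C)$ are the $E_{i,j}$ with $j<i$, and the fundamental weights $\lambda_i$ are dual to $h_i=E_{n+2-i,n+2-i}-E_{n+1-i,n+1-i}$, $1\le i\le n$. **The module.** Let $\mathscr C_m=\mathbb C[x_{i,j}\mid 1\le j\le i\le m]$. Put $V_0=\mathscr C_0=\mathbb C$ with the zero action of $sl(1)=0$. Recursively, for $m\geq 1$ and $\mu=\sum_{i=1}^{m}l_i\lambda_i$ with $l_i\in\mathbb N$, let $sl(m)$ act on $\mathscr C_{m-1}$ as in the realization attached to $\mu'=\sum_{i=1}^{m-1}l_{i+1}\lambda_i$, let $I_m\in gl(m)$ act as the scalar $c_m=-\frac1{m+1}\sum_{i=1}^m(m+1-i)\,l_i$, and let $sl(m+1)$ act on $\mathscr C_m=\mathbb C[x_1,\dots,x_m]\otimes\mathscr C_{m-1}$, where $x_i=x_{m,i}$, $D=\sum_s x_s\partial_{x_s}$, by $$E_{i,j}=x_i\partial_{x_j}\otimes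 1+1\otimes E_{i,j}\ (i\ne j),\qquad E_{i,m+1}=x_iD\otimes1+x_i\otimes I_m+\sum_{r=1}^m x_r\otimes E_{i,r},$$ $$E_{m+1,i}=-\partial_{x_i}\otimes 1,\qquad E_{i,i}-E_{m+1,m+1}=(D+x_i\partial_{x_i})\otimes 1+1\otimes(I_m+E_{i,i})$$ for $i,j\in\{1,\dots,m\}$. Let $V_m(\mu)=U(sl(m+1))\,(1\otimes V_{m-1}(\mu'))\subset\mathscr C_m$. In particular this defines $\overline M=V_n(\lambda)\subset\mathscr C_n$, with $M=V_{n-1}(\sum_{i=1}^{n-1}k_{i+1}\lambda_i)$; write $\overline M_r=\overline M\cap(\mathscr A_r\otimes M)$, where $\mathscr A_r$ is the space of homogeneous polynomials of degree $r$ in $x_{n,1},\dots,x_{n,n}$. **The minors.** For $1\le i\le n$ put $x_{i,i+1}=-1$ and $x_{i,j}=0$ for $j>i+1$. For $1\le j\le i\le n$ and $\Theta=(\theta_1,\dots,\theta_{i-j+1})\in\{1,\dots,n\}^{i-j+1}$ let $d_{i,j}(\Theta)=\det\big(x_{j+a-1,\theta_b}\big)_{1\le a,b\le i-j+1}$, and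 let $\mathbb J_{i,j}$ be the set of $\Theta$ with $d_{i,j}(\Theta)\neq0$. Let $$S_n(\lambda)=\Big\{\prod_{1\le j\le i\le n}\prod_{\Theta\in\mathbb J_{i,j}}d_{i,j}(\Theta)^{\alpha_{i,j}(\Theta)}\ \Big|\ \alpha_{i,j}(\Theta)\in\mathbb N,\ \sum_{i=j}^n\sum_{\Theta\in\mathbb J_{i,j}}\alpha_{i,j}(\Theta)\le k_{n-j+1}\text{ for }1\le j\le n\Big\},$$ and let $(S_n(\lambda))_r$ be the set of those products for which in addition $\sum_{j=1}^n\sum_{\Theta\in\mathbb J_{n,j}}\alpha_{n,j}(\Theta)=r$. **Theorem 2.4.** The subspace $V_n(\lambda)=\overline M$ of $\mathscr C_n$ is an irreducible $sl(n+1)$-submodule with highest weight $\lambda$, that is, it contains a nonzero vector of weight $\lambda$ annihilated by all positive root vectors. As a vector space it is spanned by $S_n(\lambda)$. For every $r\in\mathbb N$ the component $\overline M_r$ is spanned by $(S_n(\lambda))_r$, and $\overline M_r=0$ for $r>|\lambda|$. -/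

import Mathlib

open scoped TensorProduct

attribute [local instance 100] LieRing.ofAssociativeRing

namespace SLRealization

open MvPolynomial LieAlgebra.SpecialLinear

noncomputable section

/-! ### The projective extension of a `gl(m)`-module to an `sl(m+1)`-module -/

section Projective

variable {m : ℕ}

/-- The Euler operator `D = ∑ₛ xₛ ∂/∂xₛ` on `ℂ[x₁, …, xₘ]`. -/
def euler (m : ℕ) : Module.End ℂ (MvPolynomial (Fin m) ℂ) :=
  ∑ s : Fin m, LinearMap.mulLeft ℂ (X s) ∘ₗ (pderiv s).toLinearMap

variable {M : Type} [AddCommGroup M] [Module ℂ M]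

/-- `P ⊗ T`, acting on `ℂ[x₁, …, xₘ] ⊗ M`. -/
abbrev tens (P : Module.End ℂ (MvPolynomial (Fin m) ℂ)) (T : Module.End ℂ M) :
    Module.End ℂ (MvPolynomial (Fin m) ℂ ⊗[ℂ] M) :=
  TensorProduct.map P T

/-- The action of `E_{i,j}`, `i, j ≤ m`, `i ≠ j`: `xᵢ ∂ⱼ ⊗ 1 + 1 ⊗ E_{i,j}`. -/
def opE (ρ : Matrix (Fin m) (Fin m) ℂ →ₗ⁅ℂ⁆ Module.End ℂ M) (i j : Fin m) :
    Module.End ℂ (MvPolynomial (Fin m) ℂ ⊗[ℂ] M) :=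
  tens (LinearMap.mulLeft ℂ (X i) ∘ₗ (pderiv j).toLinearMap) 1 +
    tens 1 (ρ (Matrix.single i j 1))

/-- The action of `E_{i,m+1}`: `xᵢ D ⊗ 1 + xᵢ ⊗ Iₘ + ∑ᵣ xᵣ ⊗ E_{i,r}`. -/
def opUp (ρ : Matrix (Fin m) (Fin m) ℂ →ₗ⁅ℂ⁆ Module.End ℂ M) (i : Fin m) :
    Module.End ℂ (MvPolynomial (Fin m) ℂ ⊗[ℂ] M) :=
  tens (LinearMap.mulLeft ℂ (X i) ∘ₗ euler m) 1 +
    tens (LinearMap.mulLeft ℂ (X i)) (ρ 1) +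
    ∑ r : Fin m, tens (LinearMap.mulLeft ℂ (X r)) (ρ (Matrix.single i r 1))

/-- The action of `E_{m+1,i}`: `-∂ᵢ ⊗ 1`. -/
def opDown (M : Type) [AddCommGroup M] [Module ℂ M] (i : Fin m) :
    Module.End ℂ (MvPolynomial (Fin m) ℂ ⊗[ℂ] M) :=
  -tens (pderiv i).toLinearMap (1 : Module.End ℂ M)

/-- The action of `E_{i,i} - E_{m+1,m+1}`: `(D + xᵢ ∂ᵢ) ⊗ 1 + 1 ⊗ (Iₘ + E_{i,i})`. -/
def opH (ρ : Matrix (Fin m) (Fin m) ℂ →ₗ⁅ℂ⁆ Module.End ℂ M) (i : Fin m) :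
    Module.End ℂ (MvPolynomial (Fin m) ℂ ⊗[ℂ] M) :=
  tens (euler m + LinearMap.mulLeft ℂ (X i) ∘ₗ (pderiv i).toLinearMap) 1 +
    tens 1 (ρ 1 + ρ (Matrix.single i i 1))

/-- The linear extension of the above operators to all trace-zero matrices `a`, through
`a = ∑_{i≠j} aᵢⱼ Eᵢⱼ + ∑ᵢ a_{i,m+1} E_{i,m+1} + ∑ᵢ a_{m+1,i} E_{m+1,i}
  + ∑ᵢ aᵢᵢ (Eᵢᵢ - E_{m+1,m+1})` (indices `i, j ≤ m`). -/
def hatFun (ρ : Matrix (Fin m) (Fin m) ℂ →ₗ⁅ℂ⁆ Module.End ℂ M)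
    (a : Matrix (Fin (m + 1)) (Fin (m + 1)) ℂ) :
    Module.End ℂ (MvPolynomial (Fin m) ℂ ⊗[ℂ] M) :=
  (∑ i : Fin m, ∑ j : Fin m,
      if i = j then a i.castSucc i.castSucc • opH ρ i
      else a i.castSucc j.castSucc • opE ρ i j) +
    (∑ i : Fin m, a i.castSucc (Fin.last m) • opUp ρ i) +
    ∑ i : Fin m, a (Fin.last m) i.castSucc • opDown M i

/-! Proof that these operators represent `sl(m+1)`: they are the operators attached to the
vector fields `vf a` below. -/

/-- The row vector `(x₁, …, xₘ, -1)`. -/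
def uvec (m : ℕ) : Fin (m + 1) → MvPolynomial (Fin m) ℂ := Fin.snoc (fun i => X i) (-1)

/-- The row vector `(x₁, …, xₘ, -1) a`. -/
def uact (a : Matrix (Fin (m + 1)) (Fin (m + 1)) ℂ) (j : Fin (m + 1)) :
    MvPolynomial (Fin m) ℂ :=
  ∑ i, a i j • uvec m i

/-- Coefficients of the vector field attached to `a`. -/
def vf (a : Matrix (Fin (m + 1)) (Fin (m + 1)) ℂ) (j : Fin m) : MvPolynomial (Fin m) ℂ :=
  uact a j.castSucc + uact a (Fin.last m) * X j

theorem der_uvec (a : Matrix (Fin (m + 1)) (Fin (m + 1)) ℂ) (i : Fin (m + 1)) :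
    mkDerivation ℂ (vf a) (uvec m i) = uact a i + uact a (Fin.last m) * uvec m i := by
  refine Fin.lastCases ?_ (fun i => ?_) i
  · simp [uvec]
  · simp [uvec, vf]

theorem der_uact (a b : Matrix (Fin (m + 1)) (Fin (m + 1)) ℂ) (j : Fin (m + 1)) :
    mkDerivation ℂ (vf a) (uact b j) = uact (a * b) j + uact a (Fin.last m) * uact b j := by
  have h : uact b j = ∑ i, b i j • uvec m i := rfl
  conv_lhs => rw [h, map_sum]
  simp only [Derivation.map_smul, der_uvec, smul_add, Finset.sum_add_distrib]
  congr 1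
  · simp only [uact, Matrix.mul_apply, Finset.smul_sum, Finset.sum_smul, smul_smul]
    rw [Finset.sum_comm]
    exact Finset.sum_congr rfl fun x _ => Finset.sum_congr rfl fun y _ => by rw [mul_comm]
  · simp only [uact, Finset.mul_sum, mul_smul_comm]

theorem uact_sub (a b : Matrix (Fin (m + 1)) (Fin (m + 1)) ℂ) (j : Fin (m + 1)) :
    uact (a - b) j = uact a j - uact b j := by
  simp [uact, sub_smul]

theorem vf_lie (a b : Matrix (Fin (m + 1)) (Fin (m + 1)) ℂ) (j : Fin m) :
    mkDerivation ℂ (vf a) (vf b j) - mkDerivation ℂ (vf b) (vf a j) = vf ⁅a, b⁆ j := by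
  have hX (c : Matrix (Fin (m + 1)) (Fin (m + 1)) ℂ) :
      mkDerivation ℂ (vf c) (X j) = vf c j := by simp
  have h1 (a b : Matrix (Fin (m + 1)) (Fin (m + 1)) ℂ) :
      mkDerivation ℂ (vf a) (vf b j) = uact (a * b) j.castSucc +
        uact a (Fin.last m) * uact b j.castSucc + uact b (Fin.last m) * vf a j +
        X j * (uact (a * b) (Fin.last m) + uact a (Fin.last m) * uact b (Fin.last m)) := by
    conv_lhs => rw [vf]
    rw [map_add, Derivation.leibniz, hX, der_uact, der_uact]
    simp only [smul_eq_mul]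
    ring
  rw [h1, h1, Ring.lie_def]
  simp only [vf, uact_sub]
  ring

theorem end_lie (P Q : Module.End ℂ (MvPolynomial (Fin m) ℂ ⊗[ℂ] M)) :
    ⁅P, Q⁆ = P * Q - Q * P := rfl

theorem der_sum_apply {ι : Type} (t : Finset ι)
    (D : ι → Derivation ℂ (MvPolynomial (Fin m) ℂ) (MvPolynomial (Fin m) ℂ))
    (f : MvPolynomial (Fin m) ℂ) : (∑ i ∈ t, D i) f = ∑ i ∈ t, D i f := by
  rw [← Derivation.coeFnAddMonoidHom_apply, map_sum, Finset.sum_apply]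
  rfl

theorem pderiv_mkDerivation (v : Fin m → MvPolynomial (Fin m) ℂ) (s : Fin m)
    (f : MvPolynomial (Fin m) ℂ) :
    pderiv s (mkDerivation ℂ v f) =
      mkDerivation ℂ v (pderiv s f) + ∑ r, pderiv s (v r) * pderiv r f := by
  have h : ⁅(pderiv s : Derivation ℂ (MvPolynomial (Fin m) ℂ) (MvPolynomial (Fin m) ℂ)),
      mkDerivation ℂ v⁆ = ∑ r, (pderiv s (v r)) • pderiv r := by
    apply MvPolynomial.derivation_ext
    intro i
    rw [Derivation.commutator_apply, der_sum_apply]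
    simp [pderiv_X, Pi.single_apply, apply_ite]
  have h2 := congrArg (fun D => D f) h
  simp only [Derivation.commutator_apply] at h2
  simp only [der_sum_apply, Derivation.smul_apply, smul_eq_mul] at h2
  rw [← h2]; ring

/-- The operator `∑ f_{s,r} ⊗ E_{s,r}`. -/
def matOp (ρ : Matrix (Fin m) (Fin m) ℂ →ₗ⁅ℂ⁆ Module.End ℂ M)
    (f : Matrix (Fin m) (Fin m) (MvPolynomial (Fin m) ℂ)) :
    Module.End ℂ (MvPolynomial (Fin m) ℂ ⊗[ℂ] M) :=
  ∑ s, ∑ r, tens (LinearMap.mulLeft ℂ (f s r)) (ρ (Matrix.single s r 1))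

theorem matOp_tmul (ρ : Matrix (Fin m) (Fin m) ℂ →ₗ⁅ℂ⁆ Module.End ℂ M)
    (f : Matrix (Fin m) (Fin m) (MvPolynomial (Fin m) ℂ)) (p : MvPolynomial (Fin m) ℂ) (x : M) :
    matOp ρ f (p ⊗ₜ x) = ∑ s, ∑ r, (f s r * p) ⊗ₜ ρ (Matrix.single s r 1) x := by
  simp [matOp, LinearMap.sum_apply]

theorem matOp_add (ρ : Matrix (Fin m) (Fin m) ℂ →ₗ⁅ℂ⁆ Module.End ℂ M)
    (f g : Matrix (Fin m) (Fin m) (MvPolynomial (Fin m) ℂ)) :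
    matOp ρ (f + g) = matOp ρ f + matOp ρ g := by
  refine TensorProduct.ext' fun p x => ?_
  simp [matOp_tmul, add_mul, TensorProduct.add_tmul, Finset.sum_add_distrib]

theorem matOp_sub (ρ : Matrix (Fin m) (Fin m) ℂ →ₗ⁅ℂ⁆ Module.End ℂ M)
    (f g : Matrix (Fin m) (Fin m) (MvPolynomial (Fin m) ℂ)) :
    matOp ρ (f - g) = matOp ρ f - matOp ρ g := by
  refine TensorProduct.ext' fun p x => ?_
  simp [matOp_tmul, sub_mul, TensorProduct.sub_tmul, Finset.sum_sub_distrib]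

theorem der_matOp_lie (ρ : Matrix (Fin m) (Fin m) ℂ →ₗ⁅ℂ⁆ Module.End ℂ M)
    (D : Derivation ℂ (MvPolynomial (Fin m) ℂ) (MvPolynomial (Fin m) ℂ))
    (f : Matrix (Fin m) (Fin m) (MvPolynomial (Fin m) ℂ)) :
    tens D.toLinearMap (1 : Module.End ℂ M) * matOp ρ f -
      matOp ρ f * tens D.toLinearMap (1 : Module.End ℂ M) = matOp ρ (f.map D) := by
  refine TensorProduct.ext' fun p x => ?_
  simp only [LinearMap.sub_apply, Module.End.mul_apply, matOp_tmul, tens, TensorProduct.map_tmul,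
    map_sum, Module.End.one_apply, ← Finset.sum_sub_distrib, ← TensorProduct.sub_tmul,
    Matrix.map_apply]
  refine Finset.sum_congr rfl fun s _ => Finset.sum_congr rfl fun r _ => ?_
  congr 1
  simp only [Derivation.coeFn_coe, Derivation.leibniz, smul_eq_mul]
  ring

theorem matOp_comp (ρ : Matrix (Fin m) (Fin m) ℂ →ₗ⁅ℂ⁆ Module.End ℂ M)
    (f g : Matrix (Fin m) (Fin m) (MvPolynomial (Fin m) ℂ)) (p : MvPolynomial (Fin m) ℂ) (x : M) :
    (matOp ρ f * matOp ρ g) (p ⊗ₜ x) = ∑ s, ∑ r, ∑ a, ∑ b, (f s r * g a b * p) ⊗ₜ[ℂ]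
      ρ (Matrix.single s r 1) (ρ (Matrix.single a b 1) x) := by
  rw [Module.End.mul_apply, matOp_tmul]
  simp only [map_sum, matOp_tmul]
  calc _ = ∑ q : Fin m × Fin m, ∑ t : Fin m × Fin m, (f t.1 t.2 * (g q.1 q.2 * p)) ⊗ₜ[ℂ]
            ρ (Matrix.single t.1 t.2 1) (ρ (Matrix.single q.1 q.2 1) x) := by
          simp only [Fintype.sum_prod_type]
      _ = _ := by
          rw [Finset.sum_comm]
          simp only [Fintype.sum_prod_type, mul_assoc]

theorem matOp_mul (ρ : Matrix (Fin m) (Fin m) ℂ →ₗ⁅ℂ⁆ Module.End ℂ M)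
    (f g : Matrix (Fin m) (Fin m) (MvPolynomial (Fin m) ℂ)) :
    matOp ρ f * matOp ρ g - matOp ρ g * matOp ρ f = matOp ρ (f * g - g * f) := by
  have hρ (s r a b : Fin m) (x : M) :
      ρ (Matrix.single s r 1) (ρ (Matrix.single a b 1) x) -
        ρ (Matrix.single a b 1) (ρ (Matrix.single s r 1) x) =
      (if r = a then ρ (Matrix.single s b 1) x else 0) -
        (if b = s then ρ (Matrix.single a r 1) x else 0) := by
    have h := congrArg (fun T : Module.End ℂ M => T x)
      (ρ.map_lie (Matrix.single s r 1) (Matrix.single a b 1))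
    simp only [LieRing.of_associative_ring_bracket, LinearMap.sub_apply, Module.End.mul_apply,
      map_sub] at h
    rw [← h]
    congr 1
    · split_ifs with h1
      · subst h1; simp
      · simp [h1]
    · split_ifs with h1
      · subst h1; simp
      · simp [h1]
  refine TensorProduct.ext' fun p x => ?_
  have h1 : (matOp ρ f * matOp ρ g - matOp ρ g * matOp ρ f) (p ⊗ₜ x) =
      ∑ s, ∑ r, ∑ a, ∑ b, (f s r * g a b * p) ⊗ₜ[ℂ]
        ((if r = a then ρ (Matrix.single s b 1) x else 0) -
        (if b = s then ρ (Matrix.single a r 1) x else 0)) := by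
    have hB : (matOp ρ g * matOp ρ f) (p ⊗ₜ x) =
        ∑ s, ∑ r, ∑ a, ∑ b, (f s r * g a b * p) ⊗ₜ[ℂ]
          ρ (Matrix.single a b 1) (ρ (Matrix.single s r 1) x) := by
      rw [matOp_comp]
      calc _ = ∑ q : Fin m × Fin m, ∑ t : Fin m × Fin m, (g q.1 q.2 * f t.1 t.2 * p) ⊗ₜ[ℂ]
              ρ (Matrix.single q.1 q.2 1) (ρ (Matrix.single t.1 t.2 1) x) := by
            simp only [Fintype.sum_prod_type]
        _ = _ := by
            rw [Finset.sum_comm]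
            simp only [Fintype.sum_prod_type, mul_comm (g _ _)]
    rw [LinearMap.sub_apply, matOp_comp, hB]
    simp only [← Finset.sum_sub_distrib, ← TensorProduct.tmul_sub, hρ]
  rw [h1, matOp_sub, LinearMap.sub_apply, matOp_tmul, matOp_tmul]
  simp only [TensorProduct.tmul_sub, Finset.sum_sub_distrib]
  congr 1
  · refine Finset.sum_congr rfl fun s _ => ?_
    simp only [Matrix.mul_apply, Finset.sum_mul, TensorProduct.sum_tmul]
    rw [Finset.sum_comm]
    conv_lhs =>
      enter [2, a]
      rw [Finset.sum_comm]
    rw [Finset.sum_comm]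
    refine Finset.sum_congr rfl fun b _ => Finset.sum_congr rfl fun a _ => ?_
    rw [Finset.sum_eq_single a] <;> simp +contextual
  · simp only [Matrix.mul_apply, Finset.sum_mul, TensorProduct.sum_tmul]
    calc _ = ∑ s, ∑ r, ∑ a, (f s r * g a s * p) ⊗ₜ[ℂ] ρ (Matrix.single a r 1) x := by
          refine Finset.sum_congr rfl fun s _ => Finset.sum_congr rfl fun r _ =>
            Finset.sum_congr rfl fun a _ => ?_
          rw [Finset.sum_eq_single s] <;> simp +contextual
      _ = ∑ s, ∑ a, ∑ r, (f s r * g a s * p) ⊗ₜ[ℂ] ρ (Matrix.single a r 1) x :=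
          Finset.sum_congr rfl fun s _ => Finset.sum_comm
      _ = ∑ a, ∑ s, ∑ r, (f s r * g a s * p) ⊗ₜ[ℂ] ρ (Matrix.single a r 1) x :=
          Finset.sum_comm
      _ = _ := by
          refine Finset.sum_congr rfl fun a _ => ?_
          rw [Finset.sum_comm]
          simp only [mul_comm (f _ _)]

/-- The operator attached to a vector field. -/
def vfOp (ρ : Matrix (Fin m) (Fin m) ℂ →ₗ⁅ℂ⁆ Module.End ℂ M)
    (v : Fin m → MvPolynomial (Fin m) ℂ) : Module.End ℂ (MvPolynomial (Fin m) ℂ ⊗[ℂ] M) :=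
  tens (mkDerivation ℂ v).toLinearMap 1 + matOp ρ (Matrix.of fun s r => pderiv s (v r))

theorem vfOp_lie (ρ : Matrix (Fin m) (Fin m) ℂ →ₗ⁅ℂ⁆ Module.End ℂ M)
    (v w : Fin m → MvPolynomial (Fin m) ℂ) :
    ⁅vfOp ρ v, vfOp ρ w⁆ =
      vfOp ρ (fun j => mkDerivation ℂ v (w j) - mkDerivation ℂ w (v j)) := by
  have hD : mkDerivation ℂ (fun j => mkDerivation ℂ v (w j) - mkDerivation ℂ w (v j)) =
      ⁅mkDerivation ℂ v, mkDerivation ℂ w⁆ := by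
    apply MvPolynomial.derivation_ext
    intro i
    simp [Derivation.commutator_apply]
  have h1 : tens (mkDerivation ℂ v).toLinearMap (1 : Module.End ℂ M) *
        tens (mkDerivation ℂ w).toLinearMap (1 : Module.End ℂ M) -
      tens (mkDerivation ℂ w).toLinearMap (1 : Module.End ℂ M) *
        tens (mkDerivation ℂ v).toLinearMap (1 : Module.End ℂ M) =
      tens ⁅mkDerivation ℂ v, mkDerivation ℂ w⁆.toLinearMap 1 := by
    refine TensorProduct.ext' fun p x => ?_
    simp only [LinearMap.sub_apply, Module.End.mul_apply, tens, TensorProduct.map_tmul,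
      ← TensorProduct.sub_tmul, Module.End.one_apply]
    rfl
  have h2 : (Matrix.of fun s r => pderiv s (mkDerivation ℂ v (w r) - mkDerivation ℂ w (v r))) =
      (Matrix.of fun s r => pderiv s (w r)).map (mkDerivation ℂ v) -
      (Matrix.of fun s r => pderiv s (v r)).map (mkDerivation ℂ w) +
      ((Matrix.of fun s r => pderiv s (v r)) * (Matrix.of fun s r => pderiv s (w r)) -
        (Matrix.of fun s r => pderiv s (w r)) * (Matrix.of fun s r => pderiv s (v r))) := by
    ext1 s r
    simp only [Matrix.of_apply, Matrix.add_apply, Matrix.sub_apply, Matrix.map_apply,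
      Matrix.mul_apply, map_sub, pderiv_mkDerivation]
    ring
  rw [end_lie]
  simp only [vfOp]
  rw [h2, hD, matOp_add, matOp_sub, ← matOp_mul, ← der_matOp_lie, ← der_matOp_lie, ← h1]
  simp only [mul_add, add_mul]
  abel

theorem mkDerivation_apply' (v : Fin m → MvPolynomial (Fin m) ℂ) (p : MvPolynomial (Fin m) ℂ) :
    mkDerivation ℂ v p = ∑ i, v i * pderiv i p := by
  have h : mkDerivation ℂ v = ∑ i, v i • pderiv i := by
    apply MvPolynomial.derivation_ext
    intro j
    rw [der_sum_apply]
    simp [pderiv_X, Pi.single_apply]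
  rw [h, der_sum_apply]
  rfl

theorem uact_eq (a : Matrix (Fin (m + 1)) (Fin (m + 1)) ℂ) (j : Fin (m + 1)) :
    uact a j = ∑ i : Fin m, a i.castSucc j • X i - C (a (Fin.last m) j) := by
  rw [uact, Fin.sum_univ_castSucc]
  simp [uvec, smul_eq_C_mul, sub_eq_add_neg]

theorem pderiv_vf (a : Matrix (Fin (m + 1)) (Fin (m + 1)) ℂ) (s r : Fin m) :
    pderiv s (vf a r) = C (a s.castSucc r.castSucc) +
      (if s = r then uact a (Fin.last m) else 0) + C (a s.castSucc (Fin.last m)) * X r := by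
  have h (j : Fin (m + 1)) : pderiv s (uact a j) = C (a s.castSucc j) := by
    rw [uact_eq, map_sub, map_sum]
    simp [pderiv_X, Pi.single_apply, smul_eq_C_mul]
  rw [vf, map_add, pderiv_mul, h, h, pderiv_X, Pi.single_apply]
  split_ifs with h1 h2 h2
  · ring
  · exact absurd h1.symm h2
  · exact absurd h2.symm h1
  · ring

theorem hatFun_eq (ρ : Matrix (Fin m) (Fin m) ℂ →ₗ⁅ℂ⁆ Module.End ℂ M)
    (a : Matrix (Fin (m + 1)) (Fin (m + 1)) ℂ) (ha : a.trace = 0) :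
    hatFun ρ a = vfOp ρ (vf a) := by
  have h1 : ρ 1 = ∑ s, ρ (Matrix.single s s 1) := by
    rw [← map_sum, Matrix.sum_single_one]
  have hl : a (Fin.last m) (Fin.last m) = -∑ i : Fin m, a i.castSucc i.castSucc := by
    rw [Matrix.trace, Fin.sum_univ_castSucc] at ha
    simp only [Matrix.diag_apply] at ha
    linear_combination ha
  refine TensorProduct.ext' fun p x => ?_
  obtain ⟨y, hy⟩ : ∃ y : Fin m → Fin m → M, ∀ s r, ρ (Matrix.single s r 1) x = y s r :=
    ⟨_, fun _ _ => rfl⟩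
  have h1x : ρ 1 x = ∑ s, y s s := by
    rw [h1, LinearMap.sum_apply]
    exact Finset.sum_congr rfl fun s _ => hy s s
  obtain ⟨e, he⟩ : ∃ e, euler m p = e := ⟨_, rfl⟩
  have he' : e = ∑ i, X i * pderiv i p := by
    rw [← he, euler, LinearMap.sum_apply]
    rfl
  have hE (i j : Fin m) : opE ρ i j (p ⊗ₜ x) = (X i * pderiv j p) ⊗ₜ x + p ⊗ₜ y i j := by
    simp [opE, tens, hy]
  have hH (i : Fin m) : opH ρ i (p ⊗ₜ x) = (X i * pderiv i p) ⊗ₜ x + p ⊗ₜ y i i +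
      (e ⊗ₜ x + p ⊗ₜ ρ 1 x) := by
    simp only [opH, tens, LinearMap.add_apply, TensorProduct.map_tmul, hy, he,
      TensorProduct.add_tmul, TensorProduct.tmul_add, Module.End.one_apply,
      LinearMap.comp_apply, LinearMap.mulLeft_apply, Derivation.coeFn_coe]
    abel
  have hU (i : Fin m) : opUp ρ i (p ⊗ₜ x) = (X i * e) ⊗ₜ x + (X i * p) ⊗ₜ ρ 1 x +
      ∑ r, (X r * p) ⊗ₜ y i r := by
    simp [opUp, tens, LinearMap.sum_apply, hy, he]
  have hD (i : Fin m) : opDown M i (p ⊗ₜ x) = -(pderiv i p ⊗ₜ x) := by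
    simp [opDown, tens]
  have hL : hatFun ρ a (p ⊗ₜ x) =
      (∑ i : Fin m, ∑ j : Fin m, a i.castSucc j.castSucc • ((X i * pderiv j p) ⊗ₜ[ℂ] x)) +
      (∑ i : Fin m, ∑ j : Fin m, a i.castSucc j.castSucc • (p ⊗ₜ[ℂ] y i j)) -
      a (Fin.last m) (Fin.last m) • (e ⊗ₜ x + p ⊗ₜ ρ 1 x) +
      (∑ i : Fin m, a i.castSucc (Fin.last m) • ((X i * e) ⊗ₜ[ℂ] x)) +
      (∑ i : Fin m, a i.castSucc (Fin.last m) • ((X i * p) ⊗ₜ[ℂ] ρ 1 x)) +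
      (∑ i : Fin m, ∑ r, a i.castSucc (Fin.last m) • ((X r * p) ⊗ₜ[ℂ] y i r)) -
      ∑ i : Fin m, a (Fin.last m) i.castSucc • (pderiv i p ⊗ₜ[ℂ] x) := by
    have h0 : (∑ i : Fin m, ∑ j : Fin m, (if i = j then a i.castSucc i.castSucc • opH ρ i
        else a i.castSucc j.castSucc • opE ρ i j)) (p ⊗ₜ x) =
        (∑ i : Fin m, ∑ j : Fin m, a i.castSucc j.castSucc • ((X i * pderiv j p) ⊗ₜ[ℂ] x)) +
        (∑ i : Fin m, ∑ j : Fin m, a i.castSucc j.castSucc • (p ⊗ₜ[ℂ] y i j)) -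
        a (Fin.last m) (Fin.last m) • (e ⊗ₜ x + p ⊗ₜ ρ 1 x) := by
      have hn (c : ℂ) (t : MvPolynomial (Fin m) ℂ ⊗[ℂ] M) : -c • t = -(c • t) := neg_smul c t
      rw [hl, hn, sub_neg_eq_add, Finset.sum_smul]
      simp only [LinearMap.sum_apply, ← Finset.sum_add_distrib]
      refine Finset.sum_congr rfl fun i _ => ?_
      have : a i.castSucc i.castSucc • (e ⊗ₜ[ℂ] x + p ⊗ₜ[ℂ] ρ 1 x) =
          ∑ j, if i = j then a i.castSucc i.castSucc • (e ⊗ₜ[ℂ] x + p ⊗ₜ[ℂ] ρ 1 x) else 0 := by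
        simp
      rw [this, ← Finset.sum_add_distrib]
      refine Finset.sum_congr rfl fun j _ => ?_
      split_ifs with h
      · subst h
        rw [LinearMap.smul_apply, hH, smul_add, smul_add]
      · rw [LinearMap.smul_apply, hE, smul_add, add_zero]
    rw [hatFun, LinearMap.add_apply, LinearMap.add_apply, h0]
    simp only [LinearMap.sum_apply, LinearMap.smul_apply, hU, hD, smul_add, smul_neg,
      Finset.sum_add_distrib, Finset.smul_sum, Finset.sum_neg_distrib]
    abel
  have hR : vfOp ρ (vf a) (p ⊗ₜ x) =
      (∑ i, (uact a i.castSucc * pderiv i p) ⊗ₜ[ℂ] x) + (uact a (Fin.last m) * e) ⊗ₜ[ℂ] x +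
      ((∑ i : Fin m, ∑ j : Fin m, a i.castSucc j.castSucc • (p ⊗ₜ[ℂ] y i j)) +
       (uact a (Fin.last m) * p) ⊗ₜ[ℂ] ρ 1 x +
      (∑ i : Fin m, ∑ r, a i.castSucc (Fin.last m) • ((X r * p) ⊗ₜ[ℂ] y i r))) := by
    rw [vfOp, LinearMap.add_apply, matOp_tmul, tens, TensorProduct.map_tmul,
      Derivation.coeFn_coe, mkDerivation_apply']
    congr 1
    · rw [Module.End.one_apply, ← TensorProduct.sum_tmul, ← TensorProduct.add_tmul, he',
        Finset.mul_sum, ← Finset.sum_add_distrib]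
      congr 1
      refine Finset.sum_congr rfl fun i _ => ?_
      rw [vf]; ring
    · rw [h1x, TensorProduct.tmul_sum, ← Finset.sum_add_distrib, ← Finset.sum_add_distrib]
      refine Finset.sum_congr rfl fun i _ => ?_
      have : (uact a (Fin.last m) * p) ⊗ₜ[ℂ] y i i =
          ∑ j, (if i = j then uact a (Fin.last m) * p else 0) ⊗ₜ[ℂ] y i j := by
        rw [Finset.sum_eq_single i] <;> simp +contextual [eq_comm]
      rw [this, ← Finset.sum_add_distrib, ← Finset.sum_add_distrib]
      refine Finset.sum_congr rfl fun j _ => ?_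
      rw [Matrix.of_apply, pderiv_vf, hy, TensorProduct.smul_tmul', TensorProduct.smul_tmul',
        ← TensorProduct.add_tmul, ← TensorProduct.add_tmul, smul_eq_C_mul, smul_eq_C_mul]
      congr 1
      split_ifs <;> ring
  have hφ (q : MvPolynomial (Fin m) ℂ) (z : M) (j : Fin (m + 1)) : (uact a j * q) ⊗ₜ[ℂ] z =
      (∑ i : Fin m, a i.castSucc j • ((X i * q) ⊗ₜ[ℂ] z)) - a (Fin.last m) j • (q ⊗ₜ[ℂ] z) := by
    rw [uact_eq, sub_mul, TensorProduct.sub_tmul, Finset.sum_mul, TensorProduct.sum_tmul,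
      ← smul_eq_C_mul, TensorProduct.smul_tmul']
    simp only [TensorProduct.smul_tmul', smul_mul_assoc]
  rw [hL, hR, hφ, hφ]
  simp only [hφ, Finset.sum_sub_distrib, smul_add]
  rw [Finset.sum_comm (f := fun i j : Fin m =>
    a i.castSucc j.castSucc • ((X i * pderiv j p) ⊗ₜ[ℂ] x))]
  abel

theorem hatFun_add (ρ : Matrix (Fin m) (Fin m) ℂ →ₗ⁅ℂ⁆ Module.End ℂ M)
    (a b : Matrix (Fin (m + 1)) (Fin (m + 1)) ℂ) :
    hatFun ρ (a + b) = hatFun ρ a + hatFun ρ b := by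
  simp only [hatFun, Matrix.add_apply, add_smul, Finset.sum_add_distrib, ← ite_add_ite]
  abel

theorem hatFun_smul (ρ : Matrix (Fin m) (Fin m) ℂ →ₗ⁅ℂ⁆ Module.End ℂ M) (c : ℂ)
    (a : Matrix (Fin (m + 1)) (Fin (m + 1)) ℂ) :
    hatFun ρ (c • a) = c • hatFun ρ a := by
  simp only [hatFun, Matrix.smul_apply, smul_eq_mul, mul_smul,
      Finset.smul_sum, smul_add, smul_ite]

/-- The `sl(m+1)`-module `ℂ[x₁, …, xₘ] ⊗ M` attached to a `gl(m)`-module `M`. -/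
def hatRep (ρ : Matrix (Fin m) (Fin m) ℂ →ₗ⁅ℂ⁆ Module.End ℂ M) :
    sl (Fin (m + 1)) ℂ →ₗ⁅ℂ⁆ Module.End ℂ (MvPolynomial (Fin m) ℂ ⊗[ℂ] M) where
  toFun a := hatFun ρ a.1
  map_add' a b := hatFun_add ρ a.1 b.1
  map_smul' c a := hatFun_smul ρ c a.1
  map_lie' {a b} := by
    have h (c : sl (Fin (m + 1)) ℂ) : c.1.trace = 0 := c.2
    rw [hatFun_eq _ _ (h _), hatFun_eq _ _ (h _), hatFun_eq _ _ (h _), vfOp_lie]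
    congr 1
    funext j
    rw [vf_lie]
    rfl

/-- The projection `a ↦ a - (tr a / (m + 1)) I` of `gl(m+1)` onto `sl(m+1)`. -/
def slPart (m : ℕ) : Matrix (Fin (m + 1)) (Fin (m + 1)) ℂ →ₗ[ℂ] sl (Fin (m + 1)) ℂ where
  toFun a := ⟨a - (a.trace / ((m : ℂ) + 1)) • 1, by
    have : (m : ℂ) + 1 ≠ 0 := Nat.cast_add_one_ne_zero m
    change Matrix.trace (a - (a.trace / ((m : ℂ) + 1)) • 1) = 0
    simp only [Matrix.trace_sub, Matrix.trace_smul, Matrix.trace_one, Fintype.card_fin,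
      smul_eq_mul]
    push_cast
    field_simp
    ring⟩
  map_add' a b := by
    apply Subtype.ext
    change a + b - _ = (a - _) + (b - _)
    rw [Matrix.trace_add, add_div, add_smul]
    abel
  map_smul' r a := by
    apply Subtype.ext
    change r • a - _ = r • (a - _)
    rw [Matrix.trace_smul, smul_sub, smul_smul, smul_eq_mul, mul_div_assoc]

/-- The `gl(m+1)`-module obtained from an `sl(m+1)`-module by letting the identity matrix act as
the scalar `c`. -/
def extendGL (ρ : sl (Fin (m + 1)) ℂ →ₗ⁅ℂ⁆ Module.End ℂ M) (c : ℂ) :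
    Matrix (Fin (m + 1)) (Fin (m + 1)) ℂ →ₗ⁅ℂ⁆ Module.End ℂ M where
  toFun a := ρ (slPart m a) + (a.trace / ((m : ℂ) + 1) * c) • 1
  map_add' a b := by
    rw [map_add, map_add, Matrix.trace_add, add_div, add_mul, add_smul]
    abel
  map_smul' r a := by
    rw [map_smul, map_smul, Matrix.trace_smul, smul_eq_mul, RingHom.id_apply, smul_add, smul_smul]
    congr 2
    ring
  map_lie' {a b} := by
    have h1 : slPart m ⁅a, b⁆ = ⁅slPart m a, slPart m b⁆ := by
      apply Subtype.ext
      change ⁅a, b⁆ - (Matrix.trace ⁅a, b⁆ / _) • 1 = ⁅a - _ • 1, b - _ • 1⁆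
      rw [LieAlgebra.matrix_trace_commutator_zero]
      simp only [LieRing.of_associative_ring_bracket]
      simp [sub_mul, mul_sub, smul_sub, smul_smul, mul_comm]
      abel
    change ρ (slPart m ⁅a, b⁆) + _ = _
    rw [h1, LieAlgebra.matrix_trace_commutator_zero, LieHom.map_lie]
    simp only [LieRing.of_associative_ring_bracket]
    simp [add_mul, mul_add, smul_smul, mul_comm]
    abel

end Projective

/-! ### The polynomial algebra in the variables `x_{i,j}`, `1 ≤ j ≤ i ≤ n`

All indices are shifted down by one: `x_{i,j}` has index `(i - 1, j - 1)`. -/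

/-- Indices of the `n (n + 1) / 2` variables. -/
abbrev Idx (n : ℕ) : Type := {p : ℕ × ℕ // p.2 ≤ p.1 ∧ p.1 < n}

/-- The polynomial algebra `ℂ[x_{i,j} | 1 ≤ j ≤ i ≤ n]`. -/
abbrev Pol (n : ℕ) : Type := MvPolynomial (Idx n) ℂ

/-- The variables of `Pol (n + 1)` are those of the last row and those of `Pol n`. -/
def idxEquiv (n : ℕ) : Fin (n + 1) ⊕ Idx n ≃ Idx (n + 1) where
  toFun := Sum.elim (fun j => ⟨(n, j), by simp; omega⟩)
    (fun p => ⟨p.1, p.2.1, p.2.2.trans n.lt_succ_self⟩)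
  invFun p := if h : p.1.1 = n then Sum.inl ⟨p.1.2, by have := p.2; omega⟩
    else Sum.inr ⟨p.1, p.2.1, by have := p.2; omega⟩
  left_inv := by
    rintro (j | ⟨p, hp⟩)
    · simp
    · have : p.1 ≠ n := by omega
      simp [this]
  right_inv := by
    rintro ⟨⟨p, q⟩, hp⟩
    by_cases h : p = n
    · subst h; simp
    · simp [h]

/-- `ℂ[x_{n+1,1}, …, x_{n+1,n+1}] ⊗ ℂ[x_{i,j} | j ≤ i ≤ n] ≃ ℂ[x_{i,j} | j ≤ i ≤ n + 1]`. -/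
def polEquiv (n : ℕ) : MvPolynomial (Fin (n + 1)) ℂ ⊗[ℂ] Pol n ≃ₐ[ℂ] Pol (n + 1) :=
  (tensorEquivSum ℂ (Fin (n + 1)) (Idx n) ℂ).trans (renameEquiv ℂ (idxEquiv n))

/-! ### The modules. A weight `λ = k₁ λ₁ + ⋯ + kₙ λₙ` is given by `k : Fin n → ℕ`. -/

/-- The scalar `cₙ` by which the identity matrix of `gl(n)` acts on `Pol (n - 1)`; it is the
solution of `k₁ = -((n + 1) cₙ + ∑_{i=1}^{n-1} (n - i) k_{i+1}) / n`. -/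
def scalar (n : ℕ) (k : Fin n → ℕ) : ℂ :=
  -(∑ i : Fin n, ((n : ℂ) - (i : ℕ)) * (k i : ℂ)) / ((n : ℂ) + 1)

/-- The representation of `sl(n+1)` on `ℂ[x_{i,j} | 1 ≤ j ≤ i ≤ n]` attached to `(k₁, …, kₙ)`:
take the one of `sl(n)` on `ℂ[x_{i,j} | 1 ≤ j ≤ i ≤ n - 1]` attached to `(k₂, …, kₙ)`, extend it
to `gl(n)` by the scalar `cₙ`, and apply the projective extension. For `n = 1` this gives
`E₁₂ = y² ∂ - k₁ y`, `E₂₁ = -∂`, `E₁₁ - E₂₂ = 2 y ∂ - k₁` on `ℂ[y]`. -/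
def rep : (n : ℕ) → (k : Fin n → ℕ) → sl (Fin (n + 1)) ℂ →ₗ⁅ℂ⁆ Module.End ℂ (Pol n)
  | 0, _ => 0
  | n + 1, k =>
    ((polEquiv n).toLinearEquiv.lieConj : _ →ₗ⁅ℂ⁆ _).comp
      (hatRep (extendGL (rep n (Fin.tail k)) (scalar (n + 1) k)))

/-- `N` is an `sl(n+1)`-submodule. -/
def IsInvariant {n : ℕ} (k : Fin n → ℕ) (N : Submodule ℂ (Pol n)) : Prop :=
  ∀ a, ∀ f ∈ N, rep n k a f ∈ N

/-- `U(sl(n+1)) W`: the smallest `sl(n+1)`-submodule containing `W`. -/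
def generated {n : ℕ} (k : Fin n → ℕ) (W : Submodule ℂ (Pol n)) : Submodule ℂ (Pol n) :=
  sInf {N | W ≤ N ∧ IsInvariant k N}

/-- The module `Vₙ(λ) = U(sl(n+1)) (1 ⊗ M)`, where `M = Vₙ₋₁(k₂ λ₁ + ⋯ + kₙ λₙ₋₁)`. -/
def V : (n : ℕ) → (k : Fin n → ℕ) → Submodule ℂ (Pol n)
  | 0, _ => ⊤
  | n + 1, k => generated k
      ((V n (Fin.tail k)).map
        ((polEquiv n).toLinearMap ∘ₗ TensorProduct.mk ℂ (MvPolynomial (Fin (n + 1)) ℂ) (Pol n) 1))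

/-- `A_r ⊗ M`, where `A_r` is the space of homogeneous polynomials of degree `r` in
`x_{n,1}, …, x_{n,n}` and `M = Vₙ₋₁(k₂ λ₁ + ⋯ + kₙ λₙ₋₁)` (meaningful for `n ≥ 1`). -/
def hatComponent : (n : ℕ) → (k : Fin n → ℕ) → ℕ → Submodule ℂ (Pol n)
  | 0, _, _ => ⊤
  | n + 1, k, r =>
    (LinearMap.range (TensorProduct.mapIncl (homogeneousSubmodule (Fin (n + 1)) ℂ r)
      (V n (Fin.tail k)))).map (polEquiv n).toLinearMap

/-- The component of degree `r` of `Vₙ(λ)`: its intersection with `A_r ⊗ M`. -/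
def component (n : ℕ) (k : Fin n → ℕ) (r : ℕ) : Submodule ℂ (Pol n) :=
  V n k ⊓ hatComponent n k r

/-- `N` is an irreducible `sl(n+1)`-submodule. -/
def IsIrreducibleSubmodule {n : ℕ} (k : Fin n → ℕ) (N : Submodule ℂ (Pol n)) : Prop :=
  IsInvariant k N ∧ N ≠ ⊥ ∧
    ∀ N' : Submodule ℂ (Pol n), N' ≤ N → IsInvariant k N' → N' = ⊥ ∨ N' = N

/-- `v` is a nonzero vector of weight `k₁ λ₁ + ⋯ + kₙ λₙ` annihilated by all positive root
vectors. The positive root vectors are the `E_{i,j}` with `j < i`, and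
`h_i = E_{n+2-i,n+2-i} - E_{n+1-i,n+1-i}`, `λ_i(h_r) = δ_{i,r}`. -/
def IsHighestWeightVector {n : ℕ} (k : Fin n → ℕ) (v : Pol n) : Prop :=
  v ≠ 0 ∧
    (∀ (i j : Fin (n + 1)) (h : j < i), rep n k (single i j h.ne' 1) v = 0) ∧
    ∀ i : Fin n, rep n k (singleSubSingle i.rev.succ i.rev.castSucc 1) v = (k i : ℂ) • v

/-! ### The minors and the sets of their products -/

/-- `x_{i,j}`, extended by `x_{i,i+1} = -1` and `x_{i,j} = 0` for `j > i + 1`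
(indices shifted down by one). -/
def xx (n : ℕ) (i j : ℕ) : Pol n :=
  if h : j ≤ i ∧ i < n then X ⟨(i, j), h⟩ else if j = i + 1 then -1 else 0

/-- The minor `d_{i,j}(Θ)` with rows `j, j + 1, …, i` and columns `θ₁, …, θ_{i-j+1}`. -/
def dd (n : ℕ) (i j : Fin n) (Θ : Fin ((i : ℕ) - j + 1) → Fin n) : Pol n :=
  Matrix.det (Matrix.of fun a b : Fin ((i : ℕ) - j + 1) => xx n (j + a) (Θ b))

open Classical in
/-- The index set `J_{i,j}`: tuples `Θ` with `d_{i,j}(Θ) ≠ 0`. -/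
def J (n : ℕ) (i j : Fin n) : Finset (Fin ((i : ℕ) - j + 1) → Fin n) :=
  Finset.univ.filter fun Θ => dd n i j Θ ≠ 0

/-- Exponents `α_{i,j}(Θ)`. -/
abbrev Expo (n : ℕ) : Type := (i j : Fin n) → (Fin ((i : ℕ) - j + 1) → Fin n) → ℕ

/-- `∏_{1 ≤ j ≤ i ≤ n} ∏_{Θ ∈ J_{i,j}} d_{i,j}(Θ) ^ α_{i,j}(Θ)`. -/
def minorProd (n : ℕ) (α : Expo n) : Pol n :=
  ∏ i : Fin n, ∏ j ∈ Finset.Iic i, ∏ Θ ∈ J n i j, dd n i j Θ ^ α i j Θ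

/-- `∑_{i=j}^n ∑_{Θ ∈ J_{i,j}} α_{i,j}(Θ) ≤ k_{n-j+1}` for `j = 1, …, n`. -/
def Admissible {n : ℕ} (k : Fin n → ℕ) (α : Expo n) : Prop :=
  ∀ j : Fin n, ∑ i ∈ Finset.Ici j, ∑ Θ ∈ J n i j, α i j Θ ≤ k j.rev

/-- `∑_{j=1}^n ∑_{Θ ∈ J_{n,j}} α_{n,j}(Θ)`. -/
def lastDegree {n : ℕ} (α : Expo n) : ℕ :=
  ∑ i ∈ Finset.univ.filter (fun i : Fin n => (i : ℕ) + 1 = n), ∑ j ∈ Finset.Iic i, ∑ Θ ∈ J n i j, α i j Θ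

/-- The set `Sₙ(λ)`. -/
def S (n : ℕ) (k : Fin n → ℕ) : Set (Pol n) :=
  {f | ∃ α : Expo n, Admissible k α ∧ f = minorProd n α}

/-- The set `(Sₙ(λ))_r`. -/
def Sdeg (n : ℕ) (k : Fin n → ℕ) (r : ℕ) : Set (Pol n) :=
  {f | ∃ α : Expo n, Admissible k α ∧ lastDegree α = r ∧ f = minorProd n α}

end

end SLRealization

/-!
# Irreducible `sl(n+1)`-modules spanned by products of minors

Let `X = (x_{i,j})` be the `n × (n + 1)` matrix with `x_{i,i+1} = -1` and zeros further right.
The idea is that `X` is a chart of the big cell of the flag variety of `SL(n+1)`, that `sl(n+1)`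
acts by infinitesimal right multiplication on `X`, and that the module is the space of sections of
the line bundle of weight `λ`, which the products of Plücker coordinates span. Rows and columns
are numbered from `1` in the comments and from `0` in the code.

*The action.* By induction on `n`, an element `a` acts as `D - φ`, where `D` is a derivation with
`D X = X a + T X` for an upper triangular matrix `T`, and `φ` is the combination
`∑_j k_{n-j+1} (T_{j,j} + ⋯ + T_{n,n})` (`exists_vectorField`). By Jacobi's formula, `T` contributes
`T_{j,j} + ⋯ + T_{n,n}` to `D` of a minor with the rows `j, …, n`. So `φ` cancels this contribution
on a product of such *full* minors, with `k_{n-j+1}` factors for each `j`, and `a` acts there as on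
tensors, one column at a time (`rep_blockProd`).

*Irreducibility.* The span of these products (`blockSpan`) is therefore an equivariant image of a
space of tensors. There `a` and its conjugate transpose act by adjoint operators, so orthogonal
complements of submodules are submodules. On the other hand the `E_{i,j}` with `j < i` act as
derivatives that bring every nonzero polynomial down to the constants, so every nonzero submodule
contains `1` (`one_mem_of_invariant`). Together these show that the span is irreducible, and that `1`, a product
of full minors up to sign, is a highest weight vector. As `V` is generated by a subspace of
`blockSpan` that contains `1`, the two agree (`V_eq_blockSpan`).

*The spanning sets.* A full minor that contains the column `n + 1` is up to sign a minor without the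
last row, and so on; hence the span of the full minors with first row `j` is that of `1` and of the
`d_{i,j}(Θ)` (`minorSpan_eq`). Taking products gives `span_S_eq_blockSpan`. Expansion along the last
row puts `d_{n,j}(Θ)` into degree `1` with respect to that row, and the `d_{i,j}(Θ)` with `i < n`
into degree `0`, which gives the components (`component_eq`).
-/

namespace SLRealization

open MvPolynomial LieAlgebra.SpecialLinear

noncomputable section

/-! ### The action on products of polynomials in the last row and in the other rows -/

/-- The inclusion of the polynomials in the last row of variables. -/
def lastVars (n : ℕ) : MvPolynomial (Fin (n + 1)) ℂ →ₐ[ℂ] Pol (n + 1) :=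
  rename fun i => idxEquiv n (Sum.inl i)

/-- The inclusion of the polynomials in all rows of variables but the last one. -/
def oldVars (n : ℕ) : Pol n →ₐ[ℂ] Pol (n + 1) :=
  rename fun i => idxEquiv n (Sum.inr i)

theorem polEquiv_tmul (n : ℕ) (p : MvPolynomial (Fin (n + 1)) ℂ) (x : Pol n) :
    polEquiv n (p ⊗ₜ x) = lastVars n p * oldVars n x := by
  have h1 : (polEquiv n).toAlgHom.comp Algebra.TensorProduct.includeLeft = lastVars n := by
    ext i
    simp [polEquiv, lastVars]
  have h2 : (polEquiv n).toAlgHom.comp Algebra.TensorProduct.includeRight = oldVars n := by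
    ext i
    simp [polEquiv, oldVars]
  rw [← h1, ← h2]
  simp [← map_mul]

theorem lastVars_X (n : ℕ) (i : Fin (n + 1)) : lastVars n (X i) = xx (n + 1) n i := by
  have := i.2
  rw [xx, dif_pos (by omega), lastVars, rename_X]
  rfl

theorem oldVars_X (n : ℕ) (i : Idx n) : oldVars n (X i) = xx (n + 1) i.1.1 i.1.2 := by
  have := i.2
  rw [xx, dif_pos (by omega), oldVars, rename_X]
  rfl

theorem lastVars_uvec (n : ℕ) (i : Fin (n + 2)) :
    lastVars n (uvec (n + 1) i) = xx (n + 1) n i := by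
  refine Fin.lastCases ?_ (fun i => ?_) i
  · simp [uvec, xx]
  · simp [uvec, lastVars_X]

theorem oldVars_xx (n : ℕ) {i : ℕ} (hi : i < n) (j : ℕ) :
    oldVars n (xx n i j) = xx (n + 1) i j := by
  by_cases h : j ≤ i
  · rw [xx, dif_pos ⟨h, hi⟩, oldVars_X]
  · rw [xx, dif_neg (by tauto), xx, dif_neg (by tauto)]
    split_ifs <;> simp

/-- The action of `sl(n+2)` on a polynomial in the last row times one in the other rows: a vector
field acts on the former, and its Jacobian matrix on the latter through `gl(n+1)`. -/
theorem rep_succ_mul (n : ℕ) (k : Fin (n + 1) → ℕ) (a : sl (Fin (n + 2)) ℂ)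
    (p : MvPolynomial (Fin (n + 1)) ℂ) (x : Pol n) :
    rep (n + 1) k a (lastVars n p * oldVars n x) =
      lastVars n (mkDerivation ℂ (vf a.1) p) * oldVars n x +
      ∑ s, ∑ r, lastVars n (pderiv s (vf a.1 r) * p) *
        oldVars n (extendGL (rep n (Fin.tail k)) (scalar (n + 1) k) (Matrix.single s r 1) x) := by
  have ha : a.1.trace = 0 := a.2
  have h : rep (n + 1) k a (polEquiv n (p ⊗ₜ x)) =
      polEquiv n (hatFun (extendGL (rep n (Fin.tail k)) (scalar (n + 1) k)) a.1 (p ⊗ₜ x)) := by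
    change polEquiv n (hatFun _ a.1 ((polEquiv n).symm (polEquiv n (p ⊗ₜ x)))) = _
    rw [AlgEquiv.symm_apply_apply]
  rw [← polEquiv_tmul, h, hatFun_eq _ _ ha, vfOp, LinearMap.add_apply, matOp_tmul]
  simp only [tens, TensorProduct.map_tmul, map_add, map_sum, Matrix.of_apply,
    Module.End.one_apply, Derivation.coeFn_coe]
  simp only [polEquiv_tmul]

theorem span_lastVars_mul_oldVars (n : ℕ) (f : Pol (n + 1)) :
    f ∈ Submodule.span ℂ (Set.range fun q : MvPolynomial (Fin (n + 1)) ℂ × Pol n =>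
      lastVars n q.1 * oldVars n q.2) := by
  obtain ⟨t, rfl⟩ := (polEquiv n).surjective f
  induction t with
  | zero => simp
  | tmul p x => exact Submodule.subset_span ⟨(p, x), (polEquiv_tmul n p x).symm⟩
  | add s t hs ht => rw [map_add]; exact add_mem hs ht

theorem extendGL_single {m : ℕ} {M : Type} [AddCommGroup M] [Module ℂ M]
    (ρ : sl (Fin (m + 1)) ℂ →ₗ⁅ℂ⁆ Module.End ℂ M) (c : ℂ) (s r : Fin (m + 1)) (x : M) :
    extendGL ρ c (Matrix.single s r 1) x = ρ (slPart m (Matrix.single s r 1)) x +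
      (if s = r then c / ((m : ℂ) + 1) else 0) • x := by
  change ρ (slPart m (Matrix.single s r 1)) x +
    (((Matrix.single s r (1 : ℂ)).trace / ((m : ℂ) + 1) * c) • (1 : Module.End ℂ M)) x = _
  congr 1
  split_ifs with h
  · subst h
    simp [div_eq_inv_mul]
  · simp [Matrix.trace_single_eq_of_ne s r _ h]

/-! ### The action by first order differential operators -/

theorem derivation_comp_algHom {σ A ι : Type} [CommRing A] [Algebra ℂ A]
    (φ : MvPolynomial σ ℂ →ₐ[ℂ] A) (D : Derivation ℂ A A) (t : Finset ι) (g : ι → A)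
    (E : ι → Derivation ℂ (MvPolynomial σ ℂ) (MvPolynomial σ ℂ))
    (h : ∀ i, D (φ (X i)) = ∑ j ∈ t, g j * φ (E j (X i))) (p : MvPolynomial σ ℂ) :
    D (φ p) = ∑ j ∈ t, g j * φ (E j p) := by
  induction p using MvPolynomial.induction_on with
  | C c =>
    rw [← MvPolynomial.algebraMap_eq, AlgHom.commutes]
    simp
  | add p q hp hq => simp only [map_add, mul_add, Finset.sum_add_distrib, hp, hq]
  | mul_X p i hp =>
    rw [map_mul, Derivation.leibniz, hp, h]
    simp only [Derivation.leibniz, smul_eq_mul, map_add, map_mul, mul_add,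
      Finset.sum_add_distrib, Finset.mul_sum]
    congr 1 <;> exact Finset.sum_congr rfl fun _ _ => by ring

/-- Right multiplication of the row vector `y` by the `sl(n+1)`-part of `E_{s,r}`. -/
theorem slPart_single_mul {n : ℕ} {A : Type} [CommRing A] [Algebra ℂ A] (y : Fin (n + 1) → A)
    (s r j : Fin (n + 1)) :
    ∑ l, (slPart n (Matrix.single s r 1)).1 l j • y l =
      (if r = j then y s else 0) - (if s = r then (1 / ((n : ℂ) + 1)) • y j else 0) := by
  have h (l : Fin (n + 1)) : (slPart n (Matrix.single s r 1)).1 l j =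
      (if s = l ∧ r = j then 1 else 0) -
        (if s = r then 1 / ((n : ℂ) + 1) else 0) * (if l = j then 1 else 0) := by
    change Matrix.single s r (1 : ℂ) l j -
      ((Matrix.single s r (1 : ℂ)).trace / ((n : ℂ) + 1)) • (1 : Matrix _ _ ℂ) l j = _
    rw [Matrix.single_apply, Matrix.one_apply, smul_eq_mul]
    congr 2
    split_ifs with h
    · subst h; simp
    · simp [Matrix.trace_single_eq_of_ne s r _ h]
  simp only [h, sub_smul, Finset.sum_sub_distrib, mul_smul]
  congr 1
  · by_cases hr : r = j <;> simp [hr]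
  · split_ifs <;> simp

/-- The constants of the recursion fit: the scalar by which the identity of `gl(n+1)` acts makes
the multiplication term of the action the combination of tails of traces below. -/
theorem scalar_identity (n : ℕ) (k : Fin (n + 1) → ℕ) :
    ((n : ℂ) + 2) * (scalar (n + 1) k / ((n : ℂ) + 1)) =
      -(k 0 : ℂ) - ∑ j : Fin n, (k j.rev.succ : ℂ) * (1 - ((n : ℂ) - j) / ((n : ℂ) + 1)) := by
  have h1 : (n : ℂ) + 1 ≠ 0 := Nat.cast_add_one_ne_zero n
  have h2 : (n : ℂ) + 2 ≠ 0 := by exact_mod_cast Nat.succ_ne_zero (n + 1)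
  have h3 : ∑ j : Fin n, (k j.rev.succ : ℂ) * (1 - ((n : ℂ) - j) / ((n : ℂ) + 1)) =
      (∑ j : Fin n, ((n : ℂ) - j) * (k j.succ : ℂ)) / ((n : ℂ) + 1) := by
    rw [← Equiv.sum_comp Fin.revPerm, Finset.sum_div]
    refine Finset.sum_congr rfl fun j _ => ?_
    have hj := j.2
    rw [Fin.revPerm_apply, Fin.rev_rev, Fin.val_rev, Nat.cast_sub (by omega)]
    push_cast
    field_simp
    ring
  rw [h3, scalar, Fin.sum_univ_succ]
  push_cast
  have h4 : ∀ j : Fin n, ((n : ℂ) + 1 - ((j : ℕ) + 1)) = (n : ℂ) - j := fun j => by ring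
  simp only [Fin.val_succ, Fin.val_zero]
  push_cast
  simp only [h4]
  have h5 : (n : ℂ) + 1 + 1 ≠ 0 := by rw [add_assoc, one_add_one_eq_two]; exact h2
  field_simp
  ring

theorem sum_Ici_castSucc {A : Type} [AddCommMonoid A] {n : ℕ} (j : Fin n) (g : Fin (n + 1) → A) :
    ∑ l ∈ Finset.Ici j.castSucc, g l = ∑ l ∈ Finset.Ici j, g l.castSucc + g (Fin.last n) := by
  have h1 : Finset.Ici j.castSucc = Finset.univ.filter (j.castSucc ≤ ·) := by ext; simp
  have h2 : Finset.Ici j = Finset.univ.filter (j ≤ ·) := by ext; simp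
  rw [h1, h2, Finset.sum_filter, Finset.sum_filter, Fin.sum_univ_castSucc]
  simp [Fin.le_last]

set_option maxHeartbeats 1600000 in
/-- `sl(n+1)` acts by first order differential operators: a vector field `D`, which moves the
matrix `X = (x_{i,j})` by `D X = X a + T X` with an upper triangular `T`, plus the multiplication
by `-∑_j k_{n-j+1} (T_{j,j} + ⋯ + T_{n,n})`. Only the latter depends on the weight. -/
theorem exists_vectorField (n : ℕ) (a : sl (Fin (n + 1)) ℂ) :
    ∃ (D : Derivation ℂ (Pol n) (Pol n)) (T : Matrix (Fin n) (Fin n) (Pol n)),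
      (∀ i l, l < i → T i l = 0) ∧
      (∀ (i : Fin n) (j : Fin (n + 1)), D (xx n i j) =
        ∑ l : Fin (n + 1), a.1 l j • xx n i l + ∑ l : Fin n, T i l * xx n l j) ∧
      ∀ k f, rep n k a f = D f - (∑ j : Fin n, (k j.rev : ℂ) • ∑ l ∈ Finset.Ici j, T l l) * f := by
  induction n with
  | zero => exact ⟨0, 0, fun i => i.elim0, fun i => i.elim0, fun k f => by simp [rep]⟩
  | succ n ih =>
    choose D' T' hT hD hrep using fun s r : Fin (n + 1) => ih (slPart n (Matrix.single s r 1))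
    have hn1 : (n : ℂ) + 1 ≠ 0 := Nat.cast_add_one_ne_zero n
    obtain ⟨u, hu⟩ : ∃ u, lastVars n (uact a.1 (Fin.last (n + 1))) = u := ⟨_, rfl⟩
    obtain ⟨f, hf⟩ : ∃ f : Fin (n + 1) → Fin (n + 1) → Pol (n + 1),
      ∀ s r, lastVars n (pderiv s (vf a.1 r)) = f s r := ⟨_, fun _ _ => rfl⟩
    have hf' (s r) : f s r = C (a.1 s.castSucc r.castSucc) + (if s = r then u else 0) +
        C (a.1 s.castSucc (Fin.last (n + 1))) * xx (n + 1) n r := by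
      rw [← hf, pderiv_vf, map_add, map_add, map_mul, lastVars_X, ← hu, apply_ite (lastVars n),
        map_zero]
      simp only [← MvPolynomial.algebraMap_eq, AlgHom.commutes]
    -- the divergence of the projective vector field
    have htr : ∑ s, f s s = ((n : ℂ) + 2) • u := by
      have h1 : a.1 (Fin.last (n + 1)) (Fin.last (n + 1)) =
          -∑ i : Fin (n + 1), a.1 i.castSucc i.castSucc := by
        have ha : a.1.trace = 0 := a.2
        rw [Matrix.trace, Fin.sum_univ_castSucc] at ha
        simp only [Matrix.diag_apply] at ha
        linear_combination ha
      have h2 : u = ∑ i : Fin (n + 1), C (a.1 i.castSucc (Fin.last (n + 1))) * xx (n + 1) n i +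
          ∑ i : Fin (n + 1), C (a.1 i.castSucc i.castSucc) := by
        rw [← hu, uact_eq, h1, map_sub, map_sum, ← MvPolynomial.algebraMap_eq,
          AlgHom.commutes, map_neg, sub_neg_eq_add, map_sum]
        congr 1
        refine Finset.sum_congr rfl fun i _ => ?_
        rw [smul_eq_C_mul, map_mul, lastVars_X, ← MvPolynomial.algebraMap_eq, AlgHom.commutes]
        rfl
      simp only [hf', if_true, Finset.sum_add_distrib]
      rw [Finset.sum_const, Finset.card_univ, Fintype.card_fin, smul_eq_C_mul,
        nsmul_eq_mul]
      simp only [map_add, map_natCast, map_ofNat, Nat.cast_add, Nat.cast_one]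
      linear_combination -h2
    let D : Derivation ℂ (Pol (n + 1)) (Pol (n + 1)) := mkDerivation ℂ fun p =>
      Sum.elim (fun j => lastVars n (vf a.1 j))
        (fun q => ∑ sr : Fin (n + 1) × Fin (n + 1), f sr.1 sr.2 * oldVars n (D' sr.1 sr.2 (X q)))
        ((idxEquiv n).symm p)
    have hDlast (p) : D (lastVars n p) = lastVars n (mkDerivation ℂ (vf a.1) p) := by
      have := derivation_comp_algHom (lastVars n) D (Finset.univ : Finset Unit) (fun _ => 1)
        (fun _ => mkDerivation ℂ (vf a.1)) (fun i => by simp [D, lastVars]) p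
      simpa using this
    have hDold (p) : D (oldVars n p) = ∑ s, ∑ r, f s r * oldVars n (D' s r p) := by
      rw [derivation_comp_algHom (oldVars n) D (Finset.univ : Finset (Fin (n + 1) × Fin (n + 1)))
        (fun sr => f sr.1 sr.2) (fun sr => D' sr.1 sr.2) (fun i => by simp [D, oldVars]) p,
        Fintype.sum_prod_type]
    -- In the rows above the last, `vf a` acts by its Jacobian matrix `a + u I + a_{·,n+2} ⊗ x`. The
    -- last summand adds multiples of the last row `x` of `X`, and `u` enters again with the factor
    -- `-(n + 2) / (n + 1)` from the projection of the Jacobian matrix onto `sl(n+1)`.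
    let T : Matrix (Fin (n + 1)) (Fin (n + 1)) (Pol (n + 1)) := fun i l =>
      Fin.lastCases (motive := fun _ => Pol (n + 1))
        (Fin.lastCases (motive := fun _ => Pol (n + 1)) u (fun _ => 0) l)
        (fun i => Fin.lastCases (motive := fun _ => Pol (n + 1))
          (∑ s : Fin (n + 1), a.1 s.castSucc (Fin.last (n + 1)) • xx (n + 1) i s)
          (fun l => ∑ s, ∑ r, f s r * oldVars n (T' s r i l) -
            if i = l then (1 / ((n : ℂ) + 1)) • u else 0) l) i
    have hT1 : T (Fin.last n) (Fin.last n) = u := by simp [T]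
    have hT2 (l : Fin n) : T (Fin.last n) l.castSucc = 0 := by simp [T]
    have hT3 (i : Fin n) : T i.castSucc (Fin.last n) =
        ∑ s : Fin (n + 1), a.1 s.castSucc (Fin.last (n + 1)) • xx (n + 1) i s := by simp [T]
    have hT4 (i l : Fin n) : T i.castSucc l.castSucc =
        ∑ s, ∑ r, f s r * oldVars n (T' s r i l) -
            if i = l then (1 / ((n : ℂ) + 1)) • u else 0 := by simp [T]
    clear_value T D
    refine ⟨D, T, fun i l h => ?_, fun i j => ?_, fun k g => ?_⟩
    · induction i using Fin.lastCases with
      | last =>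
        induction l using Fin.lastCases with
        | last => exact absurd h (lt_irrefl _)
        | cast l => exact hT2 l
      | cast i =>
        induction l using Fin.lastCases with
        | last => exact absurd h (by simp [Fin.lt_def])
        | cast l =>
          have hl : l < i := by simpa using h
          rw [hT4, if_neg hl.ne']
          simp [hT _ _ i l hl]
    · induction i using Fin.lastCases with
      | last =>
        rw [Fin.val_last, ← lastVars_uvec, hDlast, der_uvec, Fin.sum_univ_castSucc (n := n), hT1]
        simp only [hT2, zero_mul, Finset.sum_const_zero, zero_add, map_add, map_mul, hu,
          Fin.val_last, lastVars_uvec]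
        congr 1
        rw [uact, map_sum]
        exact Finset.sum_congr rfl fun l _ => by rw [map_smul, lastVars_uvec]
      | cast i =>
        rw [Fin.val_castSucc, Fin.sum_univ_castSucc (n := n), Fin.sum_univ_castSucc (n := n + 1)]
        have h0 : xx (n + 1) i (n + 1) = 0 := by
          have := i.2
          rw [xx, dif_neg (by omega), if_neg (by omega)]
        simp only [Fin.val_castSucc, Fin.val_last, h0, smul_zero, add_zero]
        rw [hT3]
        induction j using Fin.lastCases with
        | last =>
          have h1 (l : Fin n) : xx (n + 1) l (n + 1) = 0 := by
            have := l.2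
            rw [xx, dif_neg (by omega), if_neg (by omega)]
          have h2 : xx (n + 1) n (n + 1) = -1 := by
            rw [xx, dif_neg (by omega), if_pos rfl]
          simp [h0, h1, h2]
        | cast j =>
          rw [Fin.val_castSucc, ← oldVars_xx n i.2, hDold]
          simp only [hD, slPart_single_mul]
          have hR : ∑ l : Fin n, T i.castSucc l.castSucc * xx (n + 1) l j =
              ∑ s, ∑ r, f s r * ∑ l : Fin n, oldVars n (T' s r i l) * xx (n + 1) l j -
                (1 / ((n : ℂ) + 1)) • u * xx (n + 1) i j := by
            simp only [hT4, sub_mul, Finset.sum_sub_distrib]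
            congr 1
            · simp only [Finset.sum_mul, Finset.mul_sum, mul_assoc]
              rw [Finset.sum_comm]
              exact Finset.sum_congr rfl fun s _ => Finset.sum_comm
            · rw [Finset.sum_eq_single i] <;> simp +contextual [eq_comm]
          rw [hR]
          have hL (s r : Fin (n + 1)) : f s r * oldVars n
              ((if r = j then xx n i s else 0) -
                (if s = r then (1 / ((n : ℂ) + 1)) • xx n i j else 0) +
                ∑ l : Fin n, T' s r i l * xx n l j) =
              (if r = j then f s r * xx (n + 1) i s else 0) -
              (if s = r then (1 / ((n : ℂ) + 1)) • (f s r * xx (n + 1) i j) else 0) +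
              f s r * ∑ l : Fin n, oldVars n (T' s r i l) * xx (n + 1) l j := by
            simp only [map_add, map_sub, map_sum, map_mul, apply_ite (oldVars n), map_zero,
              map_smul, oldVars_xx n i.2, oldVars_xx n (Fin.is_lt _), mul_add, mul_sub, mul_ite,
              mul_zero, mul_smul_comm]
          simp only [hL, Finset.sum_add_distrib, Finset.sum_sub_distrib, Finset.sum_ite_eq,
            Finset.sum_ite_eq', Finset.mem_univ, if_true]
          rw [← Finset.smul_sum, ← Finset.sum_mul, htr]
          have hS : ∑ s, f s j * xx (n + 1) i s =
              ∑ s : Fin (n + 1), a.1 s.castSucc j.castSucc • xx (n + 1) i s +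
              u * xx (n + 1) i j +
              (∑ s : Fin (n + 1), a.1 s.castSucc (Fin.last (n + 1)) • xx (n + 1) i s) *
                xx (n + 1) n j := by
            simp only [hf', add_mul, Finset.sum_add_distrib, ite_mul, zero_mul, smul_eq_C_mul,
              Finset.sum_mul]
            congr 1
            · congr 1
              simp
            · exact Finset.sum_congr rfl fun _ _ => by ring
          rw [hS]
          have h5 : (1 / ((n : ℂ) + 1)) • ((((n : ℂ) + 2) • u) * xx (n + 1) i j) =
              u * xx (n + 1) i j + (1 / ((n : ℂ) + 1)) • u * xx (n + 1) i j := by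
            have : (1 / ((n : ℂ) + 1)) * ((n : ℂ) + 2) = 1 + 1 / ((n : ℂ) + 1) := by
              field_simp; ring
            rw [smul_mul_assoc, smul_mul_assoc, smul_smul, this, add_smul, one_smul]
          rw [h5]
          ring
    -- the terms of `ρ(E_{s,r})` that multiply, including the scalar of the identity, add up to `φ`
    · refine Submodule.span_induction (p := fun g _ => rep (n + 1) k a g = D g -
        (∑ j : Fin (n + 1), (k j.rev : ℂ) • ∑ l ∈ Finset.Ici j, T l l) * g) ?_ ?_ ?_ ?_
        (span_lastVars_mul_oldVars n g)
      · rintro _ ⟨⟨p, x⟩, rfl⟩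
        have hτ : ∑ j : Fin (n + 1), (k j.rev : ℂ) • ∑ l ∈ Finset.Ici j, T l l =
            ∑ s, ∑ r, f s r * oldVars n (∑ j : Fin n, (Fin.tail k j.rev : ℂ) •
              ∑ l ∈ Finset.Ici j, T' s r l l) -
              (scalar (n + 1) k / ((n : ℂ) + 1)) • ∑ s, f s s := by
          have h1 (j : Fin n) : ∑ l ∈ Finset.Ici j.castSucc, T l l =
              ∑ s, ∑ r, f s r * oldVars n (∑ l ∈ Finset.Ici j, T' s r l l) +
              (1 - ((n : ℂ) - j) / ((n : ℂ) + 1)) • u := by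
            rw [sum_Ici_castSucc, hT1]
            simp only [hT4, if_true, Finset.sum_sub_distrib, map_sum, Finset.mul_sum]
            rw [Finset.sum_const, Fin.card_Ici, Finset.sum_comm, sub_smul, one_smul,
              ← Nat.cast_smul_eq_nsmul ℂ, smul_smul, Nat.cast_sub j.2.le, mul_one_div]
            rw [Finset.sum_congr rfl fun s _ => Finset.sum_comm]
            abel
          have hrev : (Fin.last n).rev = 0 := by simp
          have hL : Finset.Ici (Fin.last n) = {Fin.last n} := by
            ext; simp [Fin.last_le_iff]
          rw [Fin.sum_univ_castSucc, htr, smul_smul, mul_comm, scalar_identity, hrev, hL,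
            Finset.sum_singleton, hT1, sub_smul, neg_smul, Finset.sum_smul]
          simp only [h1, mul_smul, smul_add, Finset.sum_add_distrib, Fin.rev_castSucc, map_sum,
            map_smul, Finset.mul_sum, Fin.tail,
            mul_smul_comm, Finset.smul_sum]
          have h2 (F : Fin (n + 1) → Fin (n + 1) → Fin n → Pol (n + 1)) :
              ∑ s, ∑ r, ∑ j, F s r j = ∑ j, ∑ s, ∑ r, F s r j := by
            rw [Finset.sum_congr rfl fun s _ => Finset.sum_comm]
            exact Finset.sum_comm
          rw [h2]
          abel
        rw [rep_succ_mul, Derivation.leibniz, hDlast, hDold, hτ]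
        have hterm (s r : Fin (n + 1)) : lastVars n (pderiv s (vf a.1 r) * p) *
            oldVars n (extendGL (rep n (Fin.tail k)) (scalar (n + 1) k)
              (Matrix.single s r 1) x) =
            lastVars n p * (f s r * oldVars n (D' s r x)) -
            f s r * oldVars n (∑ j : Fin n, (Fin.tail k j.rev : ℂ) •
              ∑ l ∈ Finset.Ici j, T' s r l l) * (lastVars n p * oldVars n x) +
            (if s = r then (scalar (n + 1) k / ((n : ℂ) + 1)) •
              (f s r * (lastVars n p * oldVars n x)) else 0) := by
          rw [extendGL_single, hrep, map_mul, hf, map_add, map_sub, map_mul (oldVars n),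
            map_smul]
          split_ifs
          · simp only [smul_eq_C_mul]
            ring
          · rw [zero_smul]
            ring
        simp only [hterm, Finset.sum_add_distrib, Finset.sum_sub_distrib, Finset.sum_ite_eq,
          Finset.mem_univ, if_true, smul_eq_mul]
        simp only [← Finset.smul_sum, ← Finset.sum_mul, ← Finset.mul_sum, sub_mul, smul_mul_assoc]
        ring
      · simp
      · intro x y _ _ hx hy
        rw [map_add, map_add, hx, hy]; ring
      · intro c x _ hx
        rw [map_smul, Derivation.map_smul, hx, smul_sub, mul_smul_comm]

/-! ### Every nonzero submodule contains the constants -/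

theorem rep_single_last (n : ℕ) (k : Fin (n + 1) → ℕ) (i : Fin (n + 1))
    (h : Fin.last (n + 1) ≠ i.castSucc) (f : Pol (n + 1)) :
    rep (n + 1) k (single (Fin.last (n + 1)) i.castSucc h 1) f =
      -pderiv (idxEquiv n (Sum.inl i)) f := by
  have hu (j : Fin (n + 2)) : uact (single (Fin.last (n + 1)) i.castSucc h (1 : ℂ)).1 j =
      if j = i.castSucc then -1 else 0 := by
    have h0 (s : Fin (n + 1)) :
        Matrix.single (Fin.last (n + 1)) i.castSucc (1 : ℂ) s.castSucc j = 0 :=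
      Matrix.single_apply_of_row_ne (Fin.castSucc_lt_last s).ne' _ _ _
    simp only [uact_eq, val_single, h0, zero_smul, Finset.sum_const_zero, zero_sub,
      Matrix.single_apply, true_and]
    split_ifs with h1 h2 h2
    · simp
    · exact absurd h1.symm h2
    · exact absurd h2.symm h1
    · simp
  have hv (j : Fin (n + 1)) : vf (single (Fin.last (n + 1)) i.castSucc h (1 : ℂ)).1 j =
      if j = i then -1 else 0 := by
    rw [vf, hu, hu, if_neg h]
    simp
  have hd : mkDerivation ℂ (vf (single (Fin.last (n + 1)) i.castSucc h (1 : ℂ)).1) =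
      -pderiv i := by
    apply MvPolynomial.derivation_ext
    intro j
    rw [mkDerivation_X, hv, Derivation.neg_apply, pderiv_X, Pi.single_apply]
    split_ifs <;> simp
  have hz (s r : Fin (n + 1)) :
      pderiv s (vf (single (Fin.last (n + 1)) i.castSucc h (1 : ℂ)).1 r) = 0 := by
    rw [hv]
    split_ifs <;> simp
  have hl (p : MvPolynomial (Fin (n + 1)) ℂ) :
      pderiv (idxEquiv n (Sum.inl i)) (lastVars n p) = lastVars n (pderiv i p) :=
    pderiv_rename ((idxEquiv n).injective.comp Sum.inl_injective) i p
  have ho (p : Pol n) : pderiv (idxEquiv n (Sum.inl i)) (oldVars n p) = 0 := by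
    have := derivation_comp_algHom (oldVars n) (pderiv (idxEquiv n (Sum.inl i)))
      (∅ : Finset Unit) (fun _ => 0) (fun _ => 0) (fun j => by simp [oldVars, pderiv_X]) p
    simpa using this
  refine Submodule.span_induction (p := fun f _ => rep (n + 1) k _ f = -pderiv _ f) ?_ ?_ ?_ ?_
    (span_lastVars_mul_oldVars n f)
  · rintro _ ⟨⟨p, x⟩, rfl⟩
    simp only [rep_succ_mul, hd, hz, pderiv_mul, hl, ho]
    simp
  · simp
  · intro x y _ _ hx hy
    rw [map_add, map_add, hx, hy, neg_add]
  · intro c x _ hx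
    rw [map_smul, hx, Derivation.map_smul, smul_neg]

theorem rep_single_oldVars (n : ℕ) (k : Fin (n + 1) → ℕ) (i j : Fin (n + 1)) (h : i ≠ j)
    (h' : i.castSucc ≠ j.castSucc) (x : Pol n) :
    rep (n + 1) k (single i.castSucc j.castSucc h' 1) (oldVars n x) =
      oldVars n (rep n (Fin.tail k) (single i j h 1) x) := by
  have hz (s r : Fin (n + 1)) : pderiv s (vf (single i.castSucc j.castSucc h' (1 : ℂ)).1 r) =
      if s = i ∧ r = j then 1 else 0 := by
    have h0 (s : Fin (n + 2)) :
        Matrix.single i.castSucc j.castSucc (1 : ℂ) s (Fin.last (n + 1)) = 0 :=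
      Matrix.single_apply_of_col_ne _ _ (Fin.castSucc_lt_last j).ne _
    simp only [pderiv_vf, uact_eq, val_single, h0, zero_smul, Finset.sum_const_zero, C_0, sub_zero,
      ite_self, add_zero, zero_mul, Matrix.single_apply, Fin.castSucc_inj, eq_comm (a := i),
      eq_comm (a := j)]
    split_ifs <;> simp
  have hs : slPart n (Matrix.single i j 1) = single i j h 1 := by
    apply Subtype.ext
    change Matrix.single i j (1 : ℂ) - ((Matrix.single i j (1 : ℂ)).trace / ((n : ℂ) + 1)) • 1 = _
    rw [Matrix.trace_single_eq_of_ne i j _ h]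
    simp [val_single]
  have := rep_succ_mul n k (single i.castSucc j.castSucc h' 1) 1 x
  rw [map_one (lastVars n), one_mul] at this
  rw [this, Derivation.map_one_eq_zero, map_zero, zero_mul, zero_add]
  simp only [hz, mul_one, apply_ite (lastVars n), map_one, map_zero, ite_mul, one_mul, zero_mul,
    ite_and, Finset.sum_ite_irrel, Finset.sum_const_zero, Finset.sum_ite_eq', Finset.mem_univ,
    if_true]
  rw [extendGL_single, if_neg h, zero_smul, add_zero, hs]

theorem totalDegree_pderiv_lt {σ : Type} (i : σ) (f : MvPolynomial σ ℂ) (h : pderiv i f ≠ 0) :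
    (pderiv i f).totalDegree < f.totalDegree := by
  classical
  obtain ⟨m, hm, hd⟩ : ∃ m ∈ (pderiv i f).support, (pderiv i f).totalDegree = m.degree := by
    obtain ⟨m, hm, hd⟩ := Finset.exists_mem_eq_sup _ (support_nonempty.mpr h)
      (fun m : σ →₀ ℕ => m.sum fun _ e => e)
    exact ⟨m, hm, hd⟩
  have h1 : m + Finsupp.single i 1 ∈ f.support := by
    rw [mem_support_iff, coeff_pderiv] at hm
    rw [mem_support_iff]
    exact left_ne_zero_of_mul hm
  have h2 := le_totalDegree h1
  have h3 : ((m + Finsupp.single i 1).sum fun _ e => e) = m.degree + 1 := by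
    change (m + Finsupp.single i 1).degree = _
    rw [map_add, Finsupp.degree_single]
  omega

theorem notMem_vars_of_pderiv_eq_zero {σ : Type} (i : σ) (f : MvPolynomial σ ℂ)
    (h : pderiv i f = 0) : i ∉ f.vars := by
  classical
  rw [mem_vars_iff_mem_support]
  rintro ⟨m, hm, hi⟩
  have hi : m i ≠ 0 := Finsupp.mem_support_iff.mp hi
  have h1 := coeff_pderiv (i := i) f (m - Finsupp.single i 1)
  have h2 : m - Finsupp.single i 1 + Finsupp.single i 1 = m :=
    tsub_add_cancel_of_le (by rw [Finsupp.single_le_iff]; omega)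
  rw [h, coeff_zero, h2] at h1
  have h3 : (((m - Finsupp.single i 1 : σ →₀ ℕ) i : ℕ) : ℂ) + 1 ≠ 0 := Nat.cast_add_one_ne_zero _
  exact mul_ne_zero (mem_support_iff.mp hm) h3 h1.symm

/-- The positive root vectors `E_{i,j}`, `j < i`, bring every nonzero polynomial down to the
constants: they act by derivatives, first in the last row of variables, then recursively. -/
theorem one_mem_of_invariant (n : ℕ) (k : Fin n → ℕ) (N : Submodule ℂ (Pol n)) (hN : N ≠ ⊥)
    (hinv : ∀ (i j : Fin (n + 1)) (h : j < i), ∀ f ∈ N, rep n k (single i j h.ne' 1) f ∈ N) :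
    (1 : Pol n) ∈ N := by
  induction n with
  | zero =>
    obtain ⟨f, hf, hf0⟩ := Submodule.exists_mem_ne_zero_of_ne_bot hN
    have : IsEmpty (Idx 0) := ⟨fun i => absurd i.2.2 (Nat.not_lt_zero _)⟩
    obtain ⟨c, rfl⟩ := C_surjective (Idx 0) f
    have hc : c ≠ 0 := by rintro rfl; simp at hf0
    have := N.smul_mem c⁻¹ hf
    rwa [smul_eq_C_mul, ← C_mul, inv_mul_cancel₀ hc, C_1] at this
  | succ n ih =>
    -- an element of least degree has zero derivatives in the last row of variables
    obtain ⟨f, ⟨hf, hf0⟩, hmin⟩ : ∃ f : Pol (n + 1), (f ∈ N ∧ f ≠ 0) ∧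
        ∀ g : Pol (n + 1), (g ∈ N ∧ g ≠ 0) → f.totalDegree ≤ g.totalDegree := by
      obtain ⟨f, hf⟩ := Submodule.exists_mem_ne_zero_of_ne_bot hN
      obtain ⟨g, hg, hm⟩ := WellFounded.has_min (measure (totalDegree : Pol (n + 1) → ℕ)).wf
        {g | g ∈ N ∧ g ≠ 0} ⟨f, hf⟩
      exact ⟨g, hg, fun x hx => not_lt.mp (hm x hx)⟩
    have hd (i : Fin (n + 1)) : pderiv (idxEquiv n (Sum.inl i)) f = 0 := by
      by_contra hne
      have h1 : i.castSucc < Fin.last (n + 1) := Fin.castSucc_lt_last i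
      have h2 := hinv _ _ h1 f hf
      rw [rep_single_last, neg_mem_iff] at h2
      exact absurd (hmin _ ⟨h2, hne⟩) (not_le.mpr (totalDegree_pderiv_lt _ _ hne))
    obtain ⟨x, hx⟩ : ∃ x, oldVars n x = f := by
      refine exists_rename_eq_of_vars_subset_range f _
        ((idxEquiv n).injective.comp Sum.inr_injective) fun p hp => ?_
      obtain ⟨q, rfl⟩ := (idxEquiv n).surjective p
      rcases q with i | q
      · exact absurd hp (notMem_vars_of_pderiv_eq_zero _ _ (hd i))
      · exact ⟨q, rfl⟩
    have := ih (Fin.tail k) (N.comap (oldVars n).toLinearMap)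
      (fun h => by
        have hx' : x ∈ N.comap (oldVars n).toLinearMap := by
          rw [Submodule.mem_comap, AlgHom.toLinearMap_apply, hx]; exact hf
        rw [h, Submodule.mem_bot] at hx'
        exact hf0 (by rw [← hx, hx', map_zero]))
      (fun i j h y hy => by
        rw [Submodule.mem_comap, AlgHom.toLinearMap_apply] at hy ⊢
        rw [← rep_single_oldVars n k i j h.ne' (by simpa using h.ne')]
        exact hinv i.castSucc j.castSucc (by simpa using h) _ hy)
    rwa [Submodule.mem_comap, AlgHom.toLinearMap_apply, map_one] at this

/-! ### The action on products of full minors, and complete reducibility -/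

theorem derivation_prod {A ι : Type} [CommRing A] [Algebra ℂ A] [DecidableEq ι]
    (D : Derivation ℂ A A) (t : Finset ι) (f : ι → A) :
    D (∏ i ∈ t, f i) = ∑ i ∈ t, (∏ j ∈ t.erase i, f j) * D (f i) := by
  induction t using Finset.induction_on with
  | empty => simp
  | insert b t hb ih =>
    rw [Finset.prod_insert hb, Derivation.leibniz, ih, Finset.sum_insert hb,
      Finset.erase_insert hb, smul_eq_mul, smul_eq_mul, Finset.mul_sum, add_comm]
    congr 1
    refine Finset.sum_congr rfl fun i hi => ?_
    have hne : b ≠ i := by rintro rfl; exact hb hi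
    rw [Finset.erase_insert_of_ne hne, Finset.prod_insert (by simp [hb]), mul_assoc]

/-- Jacobi's formula: a derivation differentiates a determinant one column at a time. -/
theorem derivation_det {A : Type} [CommRing A] [Algebra ℂ A] {m : ℕ} (D : Derivation ℂ A A)
    (M : Matrix (Fin m) (Fin m) A) :
    D M.det = ∑ b, (M.updateCol b fun i => D (M i b)).det := by
  simp only [Matrix.det_apply, map_sum]
  rw [Finset.sum_comm]
  refine Finset.sum_congr rfl fun σ _ => ?_
  rw [← Finset.smul_sum, Units.smul_def, map_zsmul, derivation_prod, ← Units.smul_def]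
  congr 1
  refine Finset.sum_congr rfl fun b _ => ?_
  rw [← Finset.mul_prod_erase _ _ (Finset.mem_univ b), Matrix.updateCol_self, mul_comm]
  congr 1
  refine Finset.prod_congr rfl fun i hi => ?_
  rw [Matrix.updateCol_ne (Finset.ne_of_mem_erase hi)]

theorem sum_det_updateCol_mul {A : Type} [CommRing A] {m : ℕ} (M T : Matrix (Fin m) (Fin m) A) :
    ∑ b, (M.updateCol b fun i => (T * M) i b).det = T.trace * M.det := by
  have h (b : Fin m) : (M.updateCol b fun i => (T * M) i b).det =
      (M.adjugate * (T * M)) b b := by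
    rw [← Matrix.cramer_apply, Matrix.cramer_eq_adjugate_mulVec]
    rfl
  simp only [h]
  change (M.adjugate * (T * M)).trace = _
  rw [Matrix.trace_mul_comm, Matrix.mul_assoc, Matrix.mul_adjugate, Matrix.mul_smul,
    Matrix.mul_one, Matrix.trace_smul, smul_eq_mul, mul_comm]

/-- The index of the `q`-th row among the rows `j, …, n - 1`. -/
def rowFrom {n : ℕ} (j : Fin n) (q : Fin (n - j)) : Fin n := ⟨j + q, by omega⟩

theorem sum_Ici_eq {A : Type} [AddCommMonoid A] {n : ℕ} (j : Fin n) (g : Fin n → A) :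
    ∑ l ∈ Finset.Ici j, g l = ∑ q, g (rowFrom j q) := by
  symm
  refine Finset.sum_bij (fun q _ => rowFrom j q) (fun q _ => ?_) (fun p _ q _ h => ?_)
    (fun l hl => ?_) (fun _ _ => rfl)
  · simp [rowFrom, Fin.le_def]
  · simp only [rowFrom, Fin.mk.injEq] at h
    exact Fin.ext (by omega)
  · have hl : j ≤ l := Finset.mem_Ici.mp hl
    exact ⟨⟨l - j, by omega⟩, Finset.mem_univ _, Fin.ext (by simp [rowFrom]; omega)⟩

/-- The minor of the rows `j, …, n` and the columns `Θ`, where now the column `n + 1` is allowed. -/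
def fullMinor (n : ℕ) (j : Fin n) (Θ : Fin (n - j) → Fin (n + 1)) : Pol n :=
  Matrix.det (Matrix.of fun a b : Fin (n - j) => xx n (j + a) (Θ b))

/-- As `T` is upper triangular, only its block with the rows and columns `j, …, n` matters for the
minor, and it contributes its trace. -/
theorem derivation_fullMinor {n : ℕ} (a : sl (Fin (n + 1)) ℂ) (D : Derivation ℂ (Pol n) (Pol n))
    (T : Matrix (Fin n) (Fin n) (Pol n)) (hT : ∀ i l, l < i → T i l = 0)
    (hD : ∀ (i : Fin n) (j : Fin (n + 1)), D (xx n i j) =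
        ∑ l : Fin (n + 1), a.1 l j • xx n i l + ∑ l : Fin n, T i l * xx n l j)
    (j : Fin n) (Θ : Fin (n - j) → Fin (n + 1)) :
    D (fullMinor n j Θ) =
      ∑ q, ∑ l, a.1 l (Θ q) • fullMinor n j (Function.update Θ q l) +
      (∑ l ∈ Finset.Ici j, T l l) * fullMinor n j Θ := by
  let M : Matrix (Fin (n - j)) (Fin (n - j)) (Pol n) := Matrix.of fun a b => xx n (j + a) (Θ b)
  let T' : Matrix (Fin (n - j)) (Fin (n - j)) (Pol n) :=
    Matrix.of fun p q => T (rowFrom j p) (rowFrom j q)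
  have hM (p b : Fin (n - j)) : D (M p b) =
      ∑ l : Fin (n + 1), a.1 l (Θ b) • xx n (j + p) l + (T' * M) p b := by
    have h1 := hD (rowFrom j p) (Θ b)
    have h2 : ∑ l : Fin n, T (rowFrom j p) l * xx n l (Θ b) = (T' * M) p b := by
      refine Eq.trans ?_ (sum_Ici_eq j fun l => T (rowFrom j p) l * xx n l (Θ b))
      refine (Finset.sum_subset (Finset.subset_univ _) fun l _ hl => ?_).symm
      have hl : l < j := by simpa using hl
      rw [hT _ _ (lt_of_lt_of_le hl (by simp [rowFrom, Fin.le_def])), zero_mul]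
    rw [h2] at h1
    exact h1
  have hF : fullMinor n j Θ = M.det := rfl
  rw [hF, derivation_det, sum_Ici_eq j fun l => T l l]
  have hcol (b : Fin (n - j)) : (M.updateCol b fun i => D (M i b)).det =
      ∑ l, a.1 l (Θ b) • fullMinor n j (Function.update Θ b l) +
        (M.updateCol b fun i => (T' * M) i b).det := by
    have h1 : (fun i => D (M i b)) =
        (fun i : Fin (n - j) => ∑ l : Fin (n + 1), a.1 l (Θ b) • xx n (j + i) l) +
        fun i => (T' * M) i b := funext fun i => hM i b
    have h2 (l : Fin (n + 1)) : fullMinor n j (Function.update Θ b l) =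
        M.cramer (fun i => xx n (j + i) l) b := by
      rw [Matrix.cramer_apply, fullMinor]
      congr 1
      ext1 p q
      by_cases hq : q = b
      · subst hq; simp
      · simp [hq, M]
    have h3 : (fun i : Fin (n - j) => ∑ l : Fin (n + 1), a.1 l (Θ b) • xx n (j + i) l) =
        ∑ l : Fin (n + 1), (C (a.1 l (Θ b)) : Pol n) • fun i : Fin (n - j) => xx n (j + i) l := by
      ext1 i
      simp [smul_eq_C_mul]
    rw [h1, Matrix.det_updateCol_add]
    congr 1
    rw [← Matrix.cramer_apply, h3, map_sum, Finset.sum_apply]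
    refine Finset.sum_congr rfl fun l _ => ?_
    rw [map_smul, Pi.smul_apply, h2, smul_eq_C_mul, smul_eq_mul]
  simp only [hcol, Finset.sum_add_distrib, sum_det_updateCol_mul]
  rfl

/-- The factors of the products of full minors: `k_{n-j+1}` of them have the first row `j`. -/
abbrev Block {n : ℕ} (k : Fin n → ℕ) : Type := Σ j : Fin n, Fin (k j.rev)

/-- The positions of the columns in all the factors. -/
abbrev Pos {n : ℕ} (k : Fin n → ℕ) : Type := Σ b : Block k, Fin (n - b.1)

/-- The product of full minors, one for each block, with the columns `t`. -/
def blockProd {n : ℕ} (k : Fin n → ℕ) (t : Pos k → Fin (n + 1)) : Pol n :=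
  ∏ b : Block k, fullMinor n b.1 fun q => t ⟨b, q⟩

theorem blockProd_update {n : ℕ} (k : Fin n → ℕ) (t : Pos k → Fin (n + 1)) (b : Block k)
    (q : Fin (n - b.1)) (l : Fin (n + 1)) :
    blockProd k (Function.update t ⟨b, q⟩ l) =
      (∏ c ∈ Finset.univ.erase b, fullMinor n c.1 fun q => t ⟨c, q⟩) *
        fullMinor n b.1 (Function.update (fun q => t ⟨b, q⟩) q l) := by
  rw [blockProd, ← Finset.prod_erase_mul _ _ (Finset.mem_univ b)]
  congr 1
  · refine Finset.prod_congr rfl fun c hc => ?_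
    congr 1
    ext1 r
    rw [Function.update_of_ne]
    intro h
    exact Finset.ne_of_mem_erase hc (congrArg Sigma.fst h)
  · congr 1
    ext1 r
    by_cases hr : r = q
    · subst hr; simp
    · rw [Function.update_of_ne hr, Function.update_of_ne]
      intro h
      exact hr (eq_of_heq (Sigma.mk.inj h).2)

/-- `sl(n+1)` acts on the products of full minors as on tensors: on one column at a time. -/
theorem rep_blockProd {n : ℕ} (k : Fin n → ℕ) (a : sl (Fin (n + 1)) ℂ)
    (t : Pos k → Fin (n + 1)) :
    rep n k a (blockProd k t) =
      ∑ p, ∑ l, a.1 l (t p) • blockProd k (Function.update t p l) := by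
  obtain ⟨D, T, hT, hD, hrep⟩ := exists_vectorField n a
  rw [hrep, Fintype.sum_sigma]
  -- the multiplication term is the sum of the traces that the factors contribute
  have h1 : ∑ j : Fin n, (k j.rev : ℂ) • ∑ l ∈ Finset.Ici j, T l l =
      ∑ b : Block k, ∑ l ∈ Finset.Ici b.1, T l l := by
    rw [Fintype.sum_sigma]
    simp [Nat.cast_smul_eq_nsmul]
  rw [h1, blockProd, derivation_prod, Finset.sum_mul, ← Finset.sum_sub_distrib]
  refine Finset.sum_congr rfl fun b _ => ?_
  rw [derivation_fullMinor a D T hT hD]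
  simp only [blockProd_update]
  rw [← Finset.prod_erase_mul _ _ (Finset.mem_univ b), mul_add, Finset.mul_sum]
  simp only [Finset.mul_sum, mul_smul_comm]
  ring

/-- The matrix of `a` on the tensor power of `ℂ^I` with factors indexed by `P`, in the standard
basis of tuples `P → I`. -/
def tensorMatrix {P I : Type} [Fintype P] [DecidableEq P] [Fintype I] [DecidableEq I]
    (a : Matrix I I ℂ) : Matrix (P → I) (P → I) ℂ :=
  Matrix.of fun s t => ∑ p, ∑ l, if Function.update t p l = s then a l (t p) else 0

theorem tensorMatrix_conjTranspose {P I : Type} [Fintype P] [DecidableEq P] [Fintype I]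
    [DecidableEq I] (a : Matrix I I ℂ) :
    tensorMatrix (P := P) a.conjTranspose = (tensorMatrix a).conjTranspose := by
  have h (s t : P → I) (p : P) (g : I → ℂ) : ∑ l, (if Function.update t p l = s then g l else 0) =
      if ∀ q, q ≠ p → t q = s q then g (s p) else 0 := by
    have h1 (l : I) : Function.update t p l = s ↔ l = s p ∧ ∀ q, q ≠ p → t q = s q := by
      rw [Function.update_eq_iff]
    simp only [h1, ite_and]
    simp
  ext s t
  simp only [tensorMatrix, Matrix.of_apply, Matrix.conjTranspose_apply, h, star_sum]
  refine Finset.sum_congr rfl fun p _ => ?_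
  have h2 : (∀ q, q ≠ p → t q = s q) ↔ (∀ q, q ≠ p → s q = t q) :=
    forall₂_congr fun _ _ => eq_comm
  simp only [h2, apply_ite star, star_zero]

/-- Complete reducibility in the form needed: if a family of operators on the span of the images
`e i` of a basis acts by a family of matrices that is closed under adjoints, then an invariant
subspace that meets every nonzero invariant subspace is everything, because the orthogonal
complement of its preimage is invariant. -/
theorem span_le_of_conjTranspose_closed {I S Y : Type} [Fintype I] [DecidableEq I]
    [AddCommGroup Y] [Module ℂ Y] (A : S → Matrix I I ℂ) (ρ : S → Module.End ℂ Y) (e : I → Y)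
    (hstar : ∀ a, ∃ b, A b = (A a).conjTranspose) (he : ∀ a t, ρ a (e t) = ∑ s, A a s t • e s)
    (N : Submodule ℂ Y) (hN : ∀ a, ∀ f ∈ N, ρ a f ∈ N)
    (hmeet : ∀ N' ≤ Submodule.span ℂ (Set.range e), (∀ a, ∀ f ∈ N', ρ a f ∈ N') → N' ≠ ⊥ →
      N ⊓ N' ≠ ⊥) : Submodule.span ℂ (Set.range e) ≤ N := by
  let π : EuclideanSpace ℂ I →ₗ[ℂ] Y :=
    Fintype.linearCombination ℂ e ∘ₗ (WithLp.linearEquiv 2 ℂ (I → ℂ)).toLinearMap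
  have hπ (x : EuclideanSpace ℂ I) : π x = ∑ t, x t • e t := by
    simp [π, Fintype.linearCombination_apply]
  have hequiv (a : S) (x : EuclideanSpace ℂ I) :
      π (Matrix.toEuclideanLin (A a) x) = ρ a (π x) := by
    rw [hπ, hπ, map_sum]
    simp only [map_smul, he, Finset.smul_sum]
    rw [Finset.sum_comm]
    refine Finset.sum_congr rfl fun s _ => ?_
    have : Matrix.toEuclideanLin (A a) x s = ∑ t, A a s t * x t := rfl
    rw [this, Finset.sum_smul]
    exact Finset.sum_congr rfl fun t _ => by rw [smul_smul, mul_comm]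
  let P := N.comap π
  have hP (a : S) (x) (hx : x ∈ P) : Matrix.toEuclideanLin (A a) x ∈ P := by
    rw [Submodule.mem_comap] at hx ⊢
    rw [hequiv]
    exact hN a _ hx
  have hPo (a : S) (x) (hx : x ∈ Pᗮ) : Matrix.toEuclideanLin (A a) x ∈ Pᗮ := by
    obtain ⟨b, hb⟩ := hstar a
    rw [Submodule.mem_orthogonal] at hx ⊢
    intro y hy
    rw [← LinearMap.adjoint_inner_left, ← Matrix.toEuclideanLin_conjTranspose_eq_adjoint, ← hb]
    exact hx _ (hP b y hy)
  have hle : Pᗮ.map π ≤ Submodule.span ℂ (Set.range e) := by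
    rw [Submodule.map_le_iff_le_comap]
    intro x _
    rw [Submodule.mem_comap, hπ]
    exact sum_mem fun t _ => Submodule.smul_mem _ _ (Submodule.subset_span ⟨t, rfl⟩)
  have hdisj : P ⊓ Pᗮ = ⊥ := Submodule.inf_orthogonal_eq_bot P
  have hbot : Pᗮ.map π = ⊥ := by
    by_contra hne
    refine hmeet _ hle ?_ hne ?_
    · rintro a _ ⟨x, hx, rfl⟩
      exact ⟨_, hPo a x hx, hequiv a x⟩
    · rw [eq_bot_iff]
      rintro _ ⟨hy, x, hx, rfl⟩
      have : x ∈ P ⊓ Pᗮ := ⟨hy, hx⟩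
      rw [hdisj, Submodule.mem_bot] at this
      simp [this]
  have hPle : Pᗮ ≤ P := fun x hx => by
    have : π x ∈ Pᗮ.map π := ⟨x, hx, rfl⟩
    rw [hbot, Submodule.mem_bot] at this
    rw [Submodule.mem_comap, this]
    exact N.zero_mem
  have hPtop : P = ⊤ := by
    rw [← Submodule.orthogonal_eq_bot_iff]
    rw [inf_eq_right.mpr hPle] at hdisj
    exact hdisj
  rw [Submodule.span_le]
  rintro _ ⟨t, rfl⟩
  have h : EuclideanSpace.single t (1 : ℂ) ∈ P := hPtop ▸ Submodule.mem_top
  rw [Submodule.mem_comap, hπ] at h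
  simpa [Pi.single_apply] using h

/-! ### The highest weight vector and irreducibility -/

/-- The span of the products of full minors, one for each block. -/
def blockSpan {n : ℕ} (k : Fin n → ℕ) : Submodule ℂ (Pol n) :=
  Submodule.span ℂ (Set.range (blockProd k))

theorem isInvariant_blockSpan {n : ℕ} (k : Fin n → ℕ) : IsInvariant k (blockSpan k) := by
  intro a f hf
  induction hf using Submodule.span_induction with
  | mem f hf =>
    obtain ⟨t, rfl⟩ := hf
    rw [rep_blockProd]
    exact sum_mem fun p _ => sum_mem fun l _ =>
      Submodule.smul_mem _ _ (Submodule.subset_span ⟨_, rfl⟩)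
  | zero => simp
  | add f g _ _ hf hg => rw [map_add]; exact add_mem hf hg
  | smul c f _ hf => rw [map_smul]; exact Submodule.smul_mem _ c hf

/-- The columns `j + 1, …, n + 1` in every block; the product of the corresponding minors is
`± 1`. -/
def topColumns {n : ℕ} (k : Fin n → ℕ) : Pos k → Fin (n + 1) :=
  fun p => ⟨p.1.1 + p.2 + 1, by have := p.2.2; omega⟩

theorem fullMinor_top (n : ℕ) (j : Fin n) :
    fullMinor n j (fun q => ⟨j + q + 1, by have := q.2; omega⟩) = (-1) ^ (n - j : ℕ) := by
  rw [fullMinor, Matrix.det_of_isLowerTriangular]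
  · have h (q : Fin (n - j)) : xx n (j + q) (j + q + 1) = -1 := by
      rw [xx, dif_neg (by omega), if_pos rfl]
    simp [h]
  · intro p q hpq
    have h : (p : ℕ) < q := by simpa using hpq
    rw [Matrix.of_apply, xx, dif_neg (by simp; omega), if_neg (by simp; omega)]

theorem blockProd_top {n : ℕ} (k : Fin n → ℕ) :
    ∃ c : ℂ, c ≠ 0 ∧ blockProd k (topColumns k) = c • 1 := by
  refine ⟨∏ b : Block k, (-1) ^ (n - b.1 : ℕ), ?_, ?_⟩
  · exact Finset.prod_ne_zero_iff.mpr fun b _ => pow_ne_zero _ (by norm_num)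
  · rw [smul_eq_C_mul, mul_one, map_prod, blockProd]
    refine Finset.prod_congr rfl fun b _ => ?_
    rw [map_pow, map_neg, map_one]
    exact fullMinor_top n b.1

theorem one_mem_blockSpan {n : ℕ} (k : Fin n → ℕ) : (1 : Pol n) ∈ blockSpan k := by
  obtain ⟨c, hc, h⟩ := blockProd_top k
  have : (1 : Pol n) = c⁻¹ • blockProd k (topColumns k) := by
    rw [h, smul_smul, inv_mul_cancel₀ hc, one_smul]
  rw [this]
  exact Submodule.smul_mem _ _ (Submodule.subset_span ⟨_, rfl⟩)

theorem isHighestWeightVector_one {n : ℕ} (k : Fin n → ℕ) :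
    IsHighestWeightVector k (1 : Pol n) := by
  obtain ⟨c, hc, h⟩ := blockProd_top k
  have h1 (a : sl (Fin (n + 1)) ℂ) (z : ℂ)
      (ha : rep n k a (blockProd k (topColumns k)) = z • blockProd k (topColumns k)) :
      rep n k a 1 = z • 1 := by
    rw [h, map_smul, smul_comm] at ha
    exact smul_right_injective _ hc ha
  refine ⟨one_ne_zero, fun i j hij => ?_, fun i => h1 _ _ ?_⟩
  · have := h1 (single i j hij.ne' 1) 0 ?_
    · rwa [zero_smul] at this
    · rw [zero_smul, rep_blockProd]
      refine Finset.sum_eq_zero fun p _ => Finset.sum_eq_zero fun l _ => ?_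
      rw [val_single, Matrix.single_apply]
      split_ifs with hl
      · obtain ⟨rfl, hj⟩ := hl
        obtain ⟨b, q⟩ := p
        -- the column `j` is replaced by the column `i`, which occurs in the same block
        have hj' : (j : ℕ) = b.1 + q + 1 := congrArg Fin.val hj
        have hlt : (j : ℕ) < i := hij
        have hi := i.2
        have hb := b.1.2
        have hq' : (i : ℕ) - b.1 - 1 < n - b.1 := by omega
        have hne : (⟨(i : ℕ) - b.1 - 1, hq'⟩ : Fin (n - b.1)) ≠ q := by
          intro h
          have := congrArg Fin.val h
          simp only at this
          omega
        rw [blockProd_update, fullMinor, Matrix.det_zero_of_column_eq hne, mul_zero, smul_zero]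
        intro r
        simp only [Matrix.of_apply, Function.update_self, Function.update_of_ne hne, topColumns]
        congr 1
        omega
      · rw [zero_smul]
  -- in a block with the columns `j + 1, …, n + 1` the weights of the columns telescope
  · rw [rep_blockProd]
    have h2 (p : Pos k) : ∑ l, (singleSubSingle i.rev.succ i.rev.castSucc (1 : ℂ)).1 l
        (topColumns k p) • blockProd k (Function.update (topColumns k) p l) =
        ((if (i.rev : ℕ) = p.1.1 + p.2 then 1 else 0) -
          (if (i.rev : ℕ) = p.1.1 + p.2 + 1 then 1 else 0) : ℂ) •
          blockProd k (topColumns k) := by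
      rw [Finset.sum_eq_single (topColumns k p)]
      · rw [Function.update_eq_self]
        congr 1
        simp only [val_singleSubSingle, Matrix.sub_apply, Matrix.single_apply, and_self,
          topColumns, Fin.ext_iff, Fin.val_succ, Fin.val_castSucc, Nat.add_right_cancel_iff]
      · intro l _ hl
        rw [val_singleSubSingle, Matrix.sub_apply, Matrix.single_apply, Matrix.single_apply,
          if_neg, if_neg, sub_zero, zero_smul]
        · rintro ⟨rfl, h⟩; exact hl h
        · rintro ⟨rfl, h⟩; exact hl h
      · simp
    simp only [h2]
    rw [← Finset.sum_smul]
    congr 1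
    rw [Fintype.sum_sigma, Fintype.sum_sigma]
    have h3 (j : Fin n) : ∑ q : Fin (n - j), ((if (i.rev : ℕ) = j + q then 1 else 0) -
          (if (i.rev : ℕ) = j + q + 1 then 1 else 0) : ℂ) = if i.rev = j then 1 else 0 := by
      refine (sum_Ici_eq j fun l => ((if (i.rev : ℕ) = l then 1 else 0) -
          (if (i.rev : ℕ) = l + 1 then 1 else 0) : ℂ)).symm.trans ?_
      rw [Finset.sum_sub_distrib]
      have h4 : ∑ l ∈ Finset.Ici j, (if (i.rev : ℕ) = l then 1 else 0 : ℂ) =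
          if j ≤ i.rev then 1 else 0 := by
        simp only [← Fin.ext_iff, Finset.sum_ite_eq, Finset.mem_Ici]
      have h5 : ∑ l ∈ Finset.Ici j, (if (i.rev : ℕ) = l + 1 then 1 else 0 : ℂ) =
          if j < i.rev then 1 else 0 := by
        split_ifs with hj
        · have hj : (j : ℕ) < i.rev := hj
          have hr := i.rev.2
          rw [Finset.sum_eq_single (⟨(i.rev : ℕ) - 1, by omega⟩ : Fin n)]
          · rw [if_pos]; simp only; omega
          · intro l _ hl
            rw [if_neg]
            intro h
            exact hl (Fin.ext (by simp only; omega))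
          · intro h
            exact absurd (Finset.mem_Ici.mpr (Fin.le_def.mpr (by simp only; omega))) h
        · refine Finset.sum_eq_zero fun l hl => if_neg fun h => hj ?_
          have hl : (j : ℕ) ≤ l := Fin.le_def.mp (Finset.mem_Ici.mp hl)
          exact Fin.lt_def.mpr (by omega)
      rw [h4, h5]
      rcases lt_trichotomy j i.rev with h | h | h
      · simp [h, h.le, h.ne']
      · simp [h]
      · simp [h.not_ge, h.not_gt, h.ne]
    simp only [h3]
    simp [Finset.sum_ite_eq]

/-- A nonzero invariant subspace contains `1`; so the span of the products of full minors is
irreducible by complete reducibility. -/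
theorem blockSpan_le_of_isInvariant {n : ℕ} (k : Fin n → ℕ) (N : Submodule ℂ (Pol n))
    (hN : IsInvariant k N) (h0 : N ≠ ⊥) : blockSpan k ≤ N := by
  have hone (N : Submodule ℂ (Pol n)) (hN : IsInvariant k N) (h0 : N ≠ ⊥) : (1 : Pol n) ∈ N :=
    one_mem_of_invariant n k N h0 fun i j h => hN _
  refine span_le_of_conjTranspose_closed (fun a : sl (Fin (n + 1)) ℂ => tensorMatrix a.1)
    (rep n k) (blockProd k) (fun a => ?_) (fun a t => ?_) N hN fun N' _ hN' h0' h => ?_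
  · have ha : a.1.trace = 0 := a.2
    refine ⟨⟨a.1.conjTranspose, ?_⟩, tensorMatrix_conjTranspose a.1⟩
    change a.1.conjTranspose.trace = 0
    rw [Matrix.trace_conjTranspose, ha, star_zero]
  · rw [rep_blockProd]
    simp only [tensorMatrix, Matrix.of_apply, Finset.sum_smul, ite_smul, zero_smul]
    symm
    rw [Finset.sum_comm]
    refine Finset.sum_congr rfl fun p _ => ?_
    rw [Finset.sum_comm]
    exact Finset.sum_congr rfl fun l _ => by simp
  · have : (1 : Pol n) ∈ N ⊓ N' := ⟨hone N hN h0, hone N' hN' h0'⟩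
    rw [h, Submodule.mem_bot] at this
    exact one_ne_zero this

theorem isIrreducibleSubmodule_blockSpan {n : ℕ} (k : Fin n → ℕ) :
    IsIrreducibleSubmodule k (blockSpan k) := by
  refine ⟨isInvariant_blockSpan k, fun h => ?_, fun N hle hN => ?_⟩
  · have := one_mem_blockSpan k
    rw [h, Submodule.mem_bot] at this
    exact one_ne_zero this
  · by_cases h : N = ⊥
    · exact Or.inl h
    · exact Or.inr (le_antisymm hle (blockSpan_le_of_isInvariant k N hN h))

/-! ### The span of the minors with a given first row -/

/-- The minor with the `p` rows from row `j` on and the columns `Θ`. -/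
def minor (n j p : ℕ) (Θ : Fin p → ℕ) : Pol n :=
  Matrix.det (Matrix.of fun a b : Fin p => xx n (j + a) (Θ b))

theorem minor_snoc (n j p : ℕ) (Θ : Fin p → ℕ) :
    minor n j (p + 1) (Fin.snoc (α := fun _ => ℕ) Θ (j + p + 1)) = -minor n j p Θ := by
  rw [minor, Matrix.det_succ_column _ (Fin.last p), Finset.sum_eq_single (Fin.last p)]
  · have h1 : xx n (j + p) (j + p + 1) = -1 := by rw [xx, dif_neg (by omega), if_pos rfl]
    have h2 : ((Matrix.of fun a b : Fin (p + 1) => xx n (j + a)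
        (Fin.snoc (α := fun _ => ℕ) Θ (j + p + 1) b)).submatrix (Fin.last p).succAbove
          (Fin.last p).succAbove).det = minor n j p Θ := by
      rw [minor]
      congr 1
      ext1 a b
      simp
    rw [h2]
    simp [h1, ← two_mul]
  · intro a _ ha
    have ha : (a : ℕ) < p := Fin.val_lt_last ha
    have h1 : xx n (j + a) (j + p + 1) = 0 := by rw [xx, dif_neg (by omega), if_neg (by omega)]
    simp [h1]
  · simp

/-- The span of the minors with the rows `j, …, n`. -/
def minorSpan (n : ℕ) (j : Fin n) : Submodule ℂ (Pol n) :=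
  Submodule.span ℂ (Set.range (fullMinor n j))

/-- Minors with fewer rows are full minors, up to sign: in the column `i + 1` the rows up to `i`
vanish except for the entry `-1` in row `i`. -/
theorem minor_mem_minorSpan (n : ℕ) (j : Fin n) (p : ℕ) (Θ : Fin p → ℕ) (hp : j + p ≤ n)
    (hΘ : ∀ b, Θ b ≤ n) : minor n j p Θ ∈ minorSpan n j := by
  obtain ⟨d, hd⟩ : ∃ d, n = j + p + d := ⟨n - (j + p), by omega⟩
  induction d generalizing p with
  | zero =>
    obtain rfl : p = n - j := by omega
    exact Submodule.subset_span ⟨fun b => ⟨Θ b, Nat.lt_succ_of_le (hΘ b)⟩, rfl⟩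
  | succ d ih =>
    rw [← neg_mem_iff, ← minor_snoc]
    refine ih (p + 1) _ (by omega) (fun b => ?_) (by omega)
    induction b using Fin.lastCases with
    | last => rw [Fin.snoc_last]; omega
    | cast b => rw [Fin.snoc_castSucc]; exact hΘ b

theorem one_mem_minorSpan (n : ℕ) (j : Fin n) : (1 : Pol n) ∈ minorSpan n j := by
  have := minor_mem_minorSpan n j 0 Fin.elim0 (by omega) (fun b => b.elim0)
  rwa [minor, Matrix.det_fin_zero] at this

theorem dd_mem_minorSpan (n : ℕ) (i j : Fin n) (hij : j ≤ i) (Θ : Fin ((i : ℕ) - j + 1) → Fin n) :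
    dd n i j Θ ∈ minorSpan n j := by
  have hij : (j : ℕ) ≤ i := hij
  exact minor_mem_minorSpan n j _ (fun b => Θ b) (by omega) fun b => (Θ b).2.le

/-- The factors `d_{i,j}(Θ)` with given `j`, together with `1`. -/
def minorSet (n : ℕ) (j : Fin n) : Set (Pol n) :=
  {f | f = 1 ∨ ∃ i Θ, j ≤ i ∧ Θ ∈ J n i j ∧ f = dd n i j Θ}

theorem minor_mem_span_minorSet (n : ℕ) (j : Fin n) (p : ℕ) (Θ : Fin p → ℕ) (hp : j + p ≤ n)
    (hΘ : ∀ b, Θ b < n) : minor n j p Θ ∈ Submodule.span ℂ (minorSet n j) := by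
  rcases Nat.eq_zero_or_pos p with rfl | hp0
  · rw [minor, Matrix.det_fin_zero]
    exact Submodule.subset_span (Or.inl rfl)
  · obtain ⟨i, hi, hji⟩ : ∃ i : Fin n, p = i - j + 1 ∧ j ≤ i :=
      ⟨⟨j + p - 1, by omega⟩, by simp only; omega, Fin.le_def.mpr (by simp only; omega)⟩
    subst hi
    have h : minor n j _ Θ = dd n i j fun b => ⟨Θ b, hΘ b⟩ := rfl
    by_cases h0 : dd n i j (fun b => ⟨Θ b, hΘ b⟩) = 0
    · rw [h, h0]; exact Submodule.zero_mem _
    · exact Submodule.subset_span (Or.inr ⟨i, _, hji, by simpa [J] using h0, h⟩)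

/-- In a minor that reaches the last row, the column `n + 1` has the single entry `-1`, in the last
row; expansion along it removes both. -/
theorem minor_full_mem_span_minorSet (n : ℕ) (j : Fin n) (p : ℕ) (Θ : Fin p → ℕ)
    (hp : j + p = n) (hΘ : ∀ b, Θ b ≤ n) :
    minor n j p Θ ∈ Submodule.span ℂ (minorSet n j) := by
  by_cases hall : ∀ b, Θ b < n
  · exact minor_mem_span_minorSet n j p Θ hp.le hall
  push Not at hall
  obtain ⟨b, hb⟩ := hall
  have hb : Θ b = n := le_antisymm (hΘ b) hb
  obtain ⟨p, rfl⟩ : ∃ q, p = q + 1 := ⟨p - 1, by have := b.2; omega⟩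
  have hz (a : Fin (p + 1)) (ha : a ≠ Fin.last p) : xx n (j + a) n = 0 := by
    have ha : (a : ℕ) < p := Fin.val_lt_last ha
    rw [xx, dif_neg (by omega), if_neg (by omega)]
  have h : minor n j (p + 1) Θ = (-1) ^ (p + b : ℕ) * xx n (j + p) n *
      minor n j p fun c => Θ (b.succAbove c) := by
    rw [minor, Matrix.det_succ_column _ b, Finset.sum_eq_single (Fin.last p)]
    · have h2 : ((Matrix.of fun a b : Fin (p + 1) => xx n (j + a) (Θ b)).submatrix
          (Fin.last p).succAbove b.succAbove).det = minor n j p fun c => Θ (b.succAbove c) := by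
        rw [minor]
        congr 1
        ext1 a b
        simp
      rw [h2, Matrix.of_apply, hb, Fin.val_last]
    · intro a _ ha
      rw [Matrix.of_apply, hb, hz a ha, mul_zero, zero_mul]
    · simp
  have hx : xx n (j + p) n = -1 := by rw [xx, dif_neg (by omega), if_pos (by omega)]
  have hmem : minor n j p (fun c => Θ (b.succAbove c)) ∈ Submodule.span ℂ (minorSet n j) := by
    by_cases hc : ∀ c, Θ (b.succAbove c) < n
    · exact minor_mem_span_minorSet n j p _ (by omega) hc
    · push Not at hc
      obtain ⟨c, hc⟩ := hc
      have hc : Θ (b.succAbove c) = n := le_antisymm (hΘ _) hc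
      rw [minor, Matrix.det_eq_zero_of_column_eq_zero c]
      · exact Submodule.zero_mem _
      · intro a
        rw [Matrix.of_apply, hc]
        exact hz a.castSucc (Fin.castSucc_lt_last a).ne
  have hs : minor n j (p + 1) Θ = ((-1) ^ (p + b : ℕ) * (-1) : ℂ) •
      minor n j p fun c => Θ (b.succAbove c) := by
    rw [h, hx, smul_eq_C_mul]
    simp
  rw [hs]
  exact Submodule.smul_mem _ _ hmem

theorem minorSpan_eq (n : ℕ) (j : Fin n) : minorSpan n j = Submodule.span ℂ (minorSet n j) := by
  apply le_antisymm
  · rw [minorSpan, Submodule.span_le]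
    rintro _ ⟨Θ, rfl⟩
    exact minor_full_mem_span_minorSet n j _ (fun b => Θ b) (by omega) fun b =>
      Nat.lt_succ_iff.mp (Θ b).2
  · rw [Submodule.span_le]
    rintro _ (rfl | ⟨i, Θ, hij, -, rfl⟩)
    · exact one_mem_minorSpan n j
    · exact dd_mem_minorSpan n i j hij Θ

open scoped Pointwise in
theorem blockSpan_eq_prod {n : ℕ} (k : Fin n → ℕ) :
    blockSpan k = ∏ j : Fin n, minorSpan n j ^ k j.rev := by
  have h1 : ∏ j : Fin n, minorSpan n j ^ k j.rev = ∏ b : Block k, minorSpan n b.1 := by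
    rw [Fintype.prod_sigma]
    simp
  rw [h1]
  simp only [minorSpan]
  rw [Submodule.prod_span, blockSpan]
  congr 1
  ext f
  rw [Set.mem_fintype_prod]
  constructor
  · rintro ⟨t, rfl⟩
    exact ⟨fun b => fullMinor n b.1 fun q => t ⟨b, q⟩, fun {b} => ⟨_, rfl⟩, rfl⟩
  · rintro ⟨g, hg, rfl⟩
    choose t ht using fun b => @hg b
    exact ⟨fun p => t p.1 p.2, Finset.prod_congr rfl fun b _ => ht b⟩

theorem prod_mem_prod_submodule {A ι : Type} [CommRing A] [Algebra ℂ A] (s : Finset ι)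
    (N : ι → Submodule ℂ A) (f : ι → A) (h : ∀ i ∈ s, f i ∈ N i) : ∏ i ∈ s, f i ∈ ∏ i ∈ s, N i := by
  classical
  induction s using Finset.induction_on with
  | empty =>
    rw [Finset.prod_empty, Finset.prod_empty]
    exact Submodule.one_le.mp le_rfl
  | insert b s hb ih =>
    rw [Finset.prod_insert hb, Finset.prod_insert hb]
    exact Submodule.mul_mem_mul (h b (Finset.mem_insert_self _ _))
      (ih fun i hi => h i (Finset.mem_insert_of_mem hi))

theorem minorProd_eq {n : ℕ} (α : Expo n) :
    minorProd n α = ∏ j : Fin n, ∏ x ∈ (Finset.Ici j).sigma fun i => J n i j,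
      dd n x.1 j x.2 ^ α x.1 j x.2 := by
  simp only [Finset.prod_sigma]
  rw [minorProd]
  exact Finset.prod_comm' (by simp)

theorem admissible_iff {n : ℕ} (k : Fin n → ℕ) (α : Expo n) : Admissible k α ↔
    ∀ j, ∑ x ∈ (Finset.Ici j).sigma (fun i => J n i j), α x.1 j x.2 ≤ k j.rev := by
  simp only [Finset.sum_sigma]
  rfl

theorem submodule_pow_le_pow {A : Type} [CommRing A] [Algebra ℂ A] (N : Submodule ℂ A)
    (h : (1 : A) ∈ N) {a b : ℕ} (hab : a ≤ b) : N ^ a ≤ N ^ b := by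
  obtain ⟨c, rfl⟩ := Nat.exists_eq_add_of_le hab
  intro x hx
  rw [pow_add, ← mul_one x]
  refine Submodule.mul_mem_mul hx ?_
  simpa using Submodule.pow_mem_pow N h c

open scoped Pointwise in
/-- Fewer than `m` nontrivial factors are allowed, since `1` is an element of `minorSet`. -/
theorem exists_exponents {n : ℕ} (j : Fin n) (m : ℕ) (f : Pol n) (hf : f ∈ minorSet n j ^ m) :
    ∃ α : (x : Σ i : Fin n, Fin ((i : ℕ) - j + 1) → Fin n) → ℕ,
      ∑ x ∈ (Finset.Ici j).sigma (fun i => J n i j), α x ≤ m ∧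
      f = ∏ x ∈ (Finset.Ici j).sigma (fun i => J n i j), dd n x.1 j x.2 ^ α x := by
  classical
  induction m generalizing f with
  | zero =>
    rw [pow_zero, Set.mem_one] at hf
    exact ⟨0, by simp, by simp [hf]⟩
  | succ m ih =>
    rw [pow_succ, Set.mem_mul] at hf
    obtain ⟨g, hg, h, hh, rfl⟩ := hf
    obtain ⟨α, hα, rfl⟩ := ih g hg
    rcases hh with rfl | ⟨i, Θ, hij, hΘ, rfl⟩
    · exact ⟨α, by omega, by rw [mul_one]⟩
    · have hx : (⟨i, Θ⟩ : Σ i : Fin n, Fin ((i : ℕ) - j + 1) → Fin n) ∈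
          (Finset.Ici j).sigma fun i => J n i j :=
        Finset.mem_sigma.mpr ⟨Finset.mem_Ici.mpr hij, hΘ⟩
      refine ⟨fun x => α x + if x = ⟨i, Θ⟩ then 1 else 0, ?_, ?_⟩
      · rw [Finset.sum_add_distrib, Finset.sum_ite_eq' _ _ _, if_pos hx]
        omega
      · simp only [pow_add, Finset.prod_mul_distrib, pow_ite, pow_one, pow_zero]
        rw [Finset.prod_ite_eq' _ _ _, if_pos hx]

open scoped Pointwise in
theorem span_S_eq_blockSpan {n : ℕ} (k : Fin n → ℕ) :
    Submodule.span ℂ (S n k) = blockSpan k := by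
  rw [blockSpan_eq_prod]
  apply le_antisymm
  · rw [Submodule.span_le]
    rintro _ ⟨α, hα, rfl⟩
    rw [admissible_iff] at hα
    rw [minorProd_eq]
    refine prod_mem_prod_submodule _ _ _ fun j _ => ?_
    refine submodule_pow_le_pow _ (one_mem_minorSpan n j) (hα j) ?_
    rw [← Finset.prod_pow_eq_pow_sum]
    refine prod_mem_prod_submodule _ _ _ fun x hx => ?_
    exact Submodule.pow_mem_pow _ (dd_mem_minorSpan n _ _
      (Finset.mem_Ici.mp (Finset.mem_sigma.mp hx).1) _) _
  · simp only [minorSpan_eq, Submodule.span_pow]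
    rw [Submodule.prod_span, Submodule.span_le]
    intro f hf
    rw [Set.mem_fintype_prod] at hf
    obtain ⟨g, hg, rfl⟩ := hf
    choose α hα hg using fun j => exists_exponents j _ (g j) (hg j)
    refine Submodule.subset_span ⟨fun i j Θ => α j ⟨i, Θ⟩, (admissible_iff k _).mpr hα, ?_⟩
    rw [minorProd_eq]
    exact Finset.prod_congr rfl fun j _ => hg j

/-! ### The recursion for the modules, and the components -/

theorem oldVars_minor (n j p : ℕ) (Θ : Fin p → ℕ) (hp : j + p ≤ n) :
    oldVars n (minor n j p Θ) = minor (n + 1) j p Θ := by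
  rw [minor, AlgHom.map_det, minor]
  congr 1
  ext1 a b
  have := a.2
  exact oldVars_xx n (by omega) _

theorem map_oldVars_minorSpan_le (n : ℕ) (j : Fin n) :
    (minorSpan n j).map (oldVars n).toLinearMap ≤ minorSpan (n + 1) j.castSucc := by
  rw [minorSpan, Submodule.map_span, Submodule.span_le]
  rintro _ ⟨_, ⟨Θ, rfl⟩, rfl⟩
  have h : oldVars n (fullMinor n j Θ) = minor (n + 1) j (n - j) fun b => Θ b :=
    oldVars_minor n j (n - j) (fun b => Θ b) (by omega)
  change oldVars n (fullMinor n j Θ) ∈ minorSpan (n + 1) j.castSucc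
  rw [h]
  refine minor_mem_minorSpan (n + 1) j.castSucc (n - j) _ ?_ fun b => ?_
  · rw [Fin.val_castSucc]; omega
  · exact (Θ b).2.le

/-- The span, inside `Pol (n + 1)`, of the minors with first row `j` that do not meet the last row
of variables. For `j` the last row, only the minor without rows is left, which is `1`. -/
def oldPart (n : ℕ) (j : Fin (n + 1)) : Submodule ℂ (Pol (n + 1)) :=
  Fin.lastCases (motive := fun _ => Submodule ℂ (Pol (n + 1))) 1
    (fun j => (minorSpan n j).map (oldVars n).toLinearMap) j

theorem oldPart_last (n : ℕ) : oldPart n (Fin.last n) = 1 := by simp [oldPart]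

theorem oldPart_castSucc (n : ℕ) (j : Fin n) :
    oldPart n j.castSucc = (minorSpan n j).map (oldVars n).toLinearMap := by simp [oldPart]

theorem one_mem_oldPart (n : ℕ) (j : Fin (n + 1)) : (1 : Pol (n + 1)) ∈ oldPart n j := by
  induction j using Fin.lastCases with
  | last => rw [oldPart_last]; exact Submodule.one_le.mp le_rfl
  | cast j =>
    rw [oldPart_castSucc]
    exact ⟨1, one_mem_minorSpan n j, map_one (oldVars n)⟩

theorem minor_mem_oldPart (n : ℕ) (j : Fin (n + 1)) (p : ℕ) (Θ : Fin p → ℕ) (hp : j + p ≤ n)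
    (hΘ : ∀ b, Θ b ≤ n) : minor (n + 1) j p Θ ∈ oldPart n j := by
  induction j using Fin.lastCases with
  | last =>
    obtain rfl : p = 0 := by rw [Fin.val_last] at hp; omega
    rw [minor, Matrix.det_fin_zero]
    exact one_mem_oldPart n _
  | cast j =>
    rw [oldPart_castSucc]
    exact ⟨_, minor_mem_minorSpan n j p Θ hp hΘ, oldVars_minor n j p Θ hp⟩

theorem prod_oldPart {n : ℕ} (k : Fin (n + 1) → ℕ) : ∏ j, oldPart n j ^ k j.rev =
    (blockSpan (Fin.tail k)).map (oldVars n).toLinearMap := by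
  rw [Fin.prod_univ_castSucc, oldPart_last, one_pow, mul_one, blockSpan_eq_prod]
  have h : ∀ s : Finset (Fin n), (∏ j ∈ s, minorSpan n j ^ Fin.tail k j.rev).map
      (oldVars n).toLinearMap = ∏ j ∈ s, oldPart n j.castSucc ^ k j.castSucc.rev := by
    intro s
    induction s using Finset.induction_on with
    | empty => simp [Submodule.map_one]
    | insert j s hj ih =>
      rw [Finset.prod_insert hj, Finset.prod_insert hj, Submodule.map_mul, ih, Submodule.map_pow,
        oldPart_castSucc, Fin.rev_castSucc]
      rfl
  exact (h _).symm

theorem map_oldVars_blockSpan_le {n : ℕ} (k : Fin (n + 1) → ℕ) :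
    (blockSpan (Fin.tail k)).map (oldVars n).toLinearMap ≤ blockSpan k := by
  rw [← prod_oldPart, blockSpan_eq_prod]
  refine Finset.prod_le_prod' fun j _ => pow_le_pow_left' ?_ _
  induction j using Fin.lastCases with
  | last =>
    rw [oldPart_last, Submodule.one_le]
    exact one_mem_minorSpan _ _
  | cast j =>
    rw [oldPart_castSucc]
    exact map_oldVars_minorSpan_le n j

theorem isInvariant_generated {n : ℕ} (k : Fin n → ℕ) (W : Submodule ℂ (Pol n)) :
    IsInvariant k (generated k W) := by
  intro a f hf
  rw [generated, Submodule.mem_sInf] at hf ⊢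
  exact fun N hN => hN.2 a f (hf N hN)

theorem V_eq_blockSpan (n : ℕ) (k : Fin n → ℕ) : V n k = blockSpan k := by
  induction n with
  | zero =>
    refine (Submodule.eq_top_iff'.mpr fun f => ?_).symm
    have : IsEmpty (Idx 0) := ⟨fun i => absurd i.2.2 (Nat.not_lt_zero _)⟩
    obtain ⟨c, rfl⟩ := C_surjective (Idx 0) f
    rw [← mul_one (C c), ← smul_eq_C_mul]
    exact Submodule.smul_mem _ c (one_mem_blockSpan k)
  | succ n ih =>
    have hmap : (polEquiv n).toLinearMap ∘ₗ
        TensorProduct.mk ℂ (MvPolynomial (Fin (n + 1)) ℂ) (Pol n) 1 = (oldVars n).toLinearMap := by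
      refine LinearMap.ext fun x => ?_
      change polEquiv n (1 ⊗ₜ x) = oldVars n x
      rw [polEquiv_tmul, map_one, one_mul]
    have h : V (n + 1) k =
        generated k ((blockSpan (Fin.tail k)).map (oldVars n).toLinearMap) := by
      rw [V, ih, hmap]
    rw [h]
    refine le_antisymm (sInf_le ⟨map_oldVars_blockSpan_le k, isInvariant_blockSpan k⟩)
      (blockSpan_le_of_isInvariant k _ (isInvariant_generated k _) fun hbot => ?_)
    have h1 : (1 : Pol (n + 1)) ∈
        generated k ((blockSpan (Fin.tail k)).map (oldVars n).toLinearMap) := by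
      rw [generated, Submodule.mem_sInf]
      exact fun N hN => hN.1 ⟨1, one_mem_blockSpan _, map_one (oldVars n)⟩
    rw [hbot, Submodule.mem_bot] at h1
    exact one_ne_zero h1

/-- The homogeneous polynomials of degree `r` in the last row of variables. -/
def lastPart (n r : ℕ) : Submodule ℂ (Pol (n + 1)) :=
  (homogeneousSubmodule (Fin (n + 1)) ℂ r).map (lastVars n).toLinearMap

theorem lastPart_mul_le (n r s : ℕ) : lastPart n r * lastPart n s ≤ lastPart n (r + s) := by
  rw [lastPart, lastPart, ← Submodule.map_mul]
  exact Submodule.map_mono (homogeneousSubmodule_mul r s)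

theorem one_mem_lastPart (n : ℕ) : (1 : Pol (n + 1)) ∈ lastPart n 0 :=
  ⟨1, isHomogeneous_one _ _, map_one (lastVars n)⟩

theorem lastPart_pow_le (n r a : ℕ) : lastPart n r ^ a ≤ lastPart n (r * a) := by
  induction a with
  | zero =>
    rw [pow_zero, mul_zero, Submodule.one_le]
    exact one_mem_lastPart n
  | succ a ih =>
    rw [pow_succ, Nat.mul_succ]
    exact (mul_le_mul' ih le_rfl).trans (lastPart_mul_le n _ _)

theorem hatComponent_eq {n : ℕ} (k : Fin (n + 1) → ℕ) (r : ℕ) : hatComponent (n + 1) k r =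
    lastPart n r * (blockSpan (Fin.tail k)).map (oldVars n).toLinearMap := by
  rw [hatComponent, V_eq_blockSpan]
  apply le_antisymm
  · rintro _ ⟨_, ⟨t, rfl⟩, rfl⟩
    induction t with
    | zero => simp
    | tmul p x =>
      change polEquiv n (p.1 ⊗ₜ x.1) ∈ _
      rw [polEquiv_tmul]
      exact Submodule.mul_mem_mul ⟨_, p.2, rfl⟩ ⟨_, x.2, rfl⟩
    | add s t hs ht => rw [map_add, map_add]; exact add_mem hs ht
  · rw [Submodule.mul_le]
    rintro _ ⟨p, hp, rfl⟩ _ ⟨x, hx, rfl⟩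
    exact ⟨p ⊗ₜ x, ⟨⟨p, hp⟩ ⊗ₜ ⟨x, hx⟩, rfl⟩, polEquiv_tmul n p x⟩

/-- Expansion along the last row: a minor that meets the last row has degree `1` in it. -/
theorem dd_mem_lastPart_mul (n : ℕ) (i j : Fin (n + 1)) (hij : j ≤ i)
    (Θ : Fin ((i : ℕ) - j + 1) → Fin (n + 1)) :
    dd (n + 1) i j Θ ∈ lastPart n (if i = Fin.last n then 1 else 0) * oldPart n j := by
  have hij' : (j : ℕ) ≤ i := hij
  split_ifs with hi
  · subst hi
    have hxx (c : Fin (n + 1)) : xx (n + 1) (j + ((Fin.last n : ℕ) - j)) c ∈ lastPart n 1 := by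
      have h : (j : ℕ) + ((Fin.last n : ℕ) - j) = n := by rw [Fin.val_last] at *; omega
      rw [h, ← lastVars_X]
      exact ⟨X c, isHomogeneous_X ℂ c, rfl⟩
    rw [dd, Matrix.det_succ_row _ (Fin.last _)]
    refine sum_mem fun b _ => ?_
    rw [mul_assoc]
    have h1 : ((-1 : Pol (n + 1)) ^ ((Fin.last ((Fin.last n : ℕ) - j) : ℕ) + b)) =
        C ((-1) ^ ((Fin.last ((Fin.last n : ℕ) - j) : ℕ) + b)) := by simp
    rw [h1, ← smul_eq_C_mul]
    refine Submodule.smul_mem _ _ (Submodule.mul_mem_mul (hxx (Θ b)) ?_)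
    have h2 : ((Matrix.of fun a b : Fin ((Fin.last n : ℕ) - j + 1) =>
        xx (n + 1) (j + a) (Θ b)).submatrix (Fin.last _).succAbove b.succAbove).det =
        minor (n + 1) j ((Fin.last n : ℕ) - j) fun c => Θ (b.succAbove c) := by
      rw [minor]
      congr 1
      ext1 a c
      simp
    rw [h2]
    exact minor_mem_oldPart n j _ _ (by rw [Fin.val_last] at *; omega) fun c =>
      Nat.lt_succ_iff.mp (Θ _).2
  · rw [← one_mul (dd _ _ _ _)]
    refine Submodule.mul_mem_mul (one_mem_lastPart n) ?_
    have hi' : (i : ℕ) < n := Fin.val_lt_last hi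
    exact minor_mem_oldPart n j _ (fun b => Θ b) (by omega) fun b => Nat.lt_succ_iff.mp (Θ b).2

theorem prod_pow_mem_lastPart_mul {n : ℕ} {ι : Type} (s : Finset ι) (f : ι → Pol (n + 1))
    (e α : ι → ℕ) (O : ι → Submodule ℂ (Pol (n + 1)))
    (h : ∀ x ∈ s, f x ∈ lastPart n (e x) * O x) :
    ∏ x ∈ s, f x ^ α x ∈ lastPart n (∑ x ∈ s, e x * α x) * ∏ x ∈ s, O x ^ α x := by
  classical
  induction s using Finset.induction_on with
  | empty =>
    rw [Finset.prod_empty, Finset.prod_empty, Finset.sum_empty, mul_one]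
    exact one_mem_lastPart n
  | insert b s hb ih =>
    rw [Finset.prod_insert hb, Finset.prod_insert hb, Finset.sum_insert hb]
    have h1 := Submodule.pow_mem_pow _ (h b (Finset.mem_insert_self _ _)) (α b)
    rw [mul_pow] at h1
    have h2 := Submodule.mul_mem_mul h1 (ih fun i hi => h i (Finset.mem_insert_of_mem hi))
    rw [mul_mul_mul_comm] at h2
    exact mul_le_mul' ((mul_le_mul' (lastPart_pow_le _ _ _) le_rfl).trans
      (lastPart_mul_le _ _ _)) le_rfl h2

theorem lastDegree_eq {n : ℕ} (α : Expo (n + 1)) : lastDegree α =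
    ∑ j, ∑ x ∈ (Finset.Ici j).sigma fun i => J (n + 1) i j,
      (if x.1 = Fin.last n then 1 else 0) * α x.1 j x.2 := by
  simp only [Finset.sum_sigma]
  rw [lastDegree, Finset.sum_filter]
  have h (i : Fin (n + 1)) : (i : ℕ) + 1 = n + 1 ↔ i = Fin.last n := by
    rw [Fin.ext_iff, Fin.val_last]; omega
  rw [← Finset.sum_comm' (s := Finset.univ) (t := fun i : Fin (n + 1) => Finset.Iic i) (by simp)]
  refine Finset.sum_congr rfl fun i _ => ?_
  simp only [h]
  split_ifs <;> simp

theorem minorProd_mem_hatComponent {n : ℕ} (k : Fin (n + 1) → ℕ) (α : Expo (n + 1))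
    (hα : Admissible k α) : minorProd (n + 1) α ∈ hatComponent (n + 1) k (lastDegree α) := by
  rw [admissible_iff] at hα
  rw [hatComponent_eq, ← prod_oldPart, minorProd_eq, lastDegree_eq]
  have h (j : Fin (n + 1)) := prod_pow_mem_lastPart_mul
    ((Finset.Ici j).sigma fun i => J (n + 1) i j) (fun x => dd (n + 1) x.1 j x.2)
    (fun x => if x.1 = Fin.last n then 1 else 0) (fun x => α x.1 j x.2) (fun _ => oldPart n j)
    fun x hx => dd_mem_lastPart_mul n x.1 j (Finset.mem_Ici.mp (Finset.mem_sigma.mp hx).1) x.2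
  have h2 := prod_pow_mem_lastPart_mul Finset.univ _ _ (fun _ => 1) _ fun j _ => h j
  simp only [pow_one, mul_one] at h2
  suffices h3 : ∏ j, ∏ x ∈ (Finset.Ici j).sigma (fun i => J (n + 1) i j),
      oldPart n j ^ α x.1 j x.2 ≤ ∏ j, oldPart n j ^ k j.rev from mul_le_mul' le_rfl h3 h2
  refine Finset.prod_le_prod' fun j _ => ?_
  rw [Finset.prod_pow_eq_pow_sum]
  exact submodule_pow_le_pow _ (one_mem_oldPart n j) (hα j)

theorem lastDegree_le {n : ℕ} (k : Fin (n + 1) → ℕ) (α : Expo (n + 1)) (hα : Admissible k α) :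
    lastDegree α ≤ ∑ i, k i := by
  rw [admissible_iff] at hα
  rw [lastDegree_eq, ← Equiv.sum_comp Fin.revPerm k]
  refine Finset.sum_le_sum fun j _ => (Finset.sum_le_sum fun x _ => ?_).trans (hα j)
  split_ifs <;> simp

/-- The weight that counts the degree in the last row of variables. -/
def lastWeight (n : ℕ) : Idx (n + 1) → ℕ := fun p => if p.1.1 = n then 1 else 0

theorem isWeightedHomogeneous_rename {σ τ : Type} (g : σ → τ) (w : τ → ℕ) (p : MvPolynomial σ ℂ)
    (r : ℕ) (hp : IsWeightedHomogeneous (fun i => w (g i)) p r) :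
    IsWeightedHomogeneous w (rename g p) r := by
  intro d hd
  obtain ⟨u, rfl, hu⟩ := coeff_rename_ne_zero g p d hd
  rw [← hp hu, Finsupp.weight_apply, Finsupp.weight_apply,
    Finsupp.sum_mapDomain_index (by simp) (by simp [add_mul])]

theorem isWeightedHomogeneous_of_mem_hatComponent {n : ℕ} (k : Fin (n + 1) → ℕ) (r : ℕ)
    (f : Pol (n + 1)) (hf : f ∈ hatComponent (n + 1) k r) :
    IsWeightedHomogeneous (lastWeight n) f r := by
  rw [hatComponent_eq] at hf
  suffices h : lastPart n r * (blockSpan (Fin.tail k)).map (oldVars n).toLinearMap ≤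
      weightedHomogeneousSubmodule ℂ (lastWeight n) r from h hf
  have h1 (p : MvPolynomial (Fin (n + 1)) ℂ) (hp : p.IsHomogeneous r) :
      IsWeightedHomogeneous (lastWeight n) (lastVars n p) r := by
    refine isWeightedHomogeneous_rename _ _ _ _ ?_
    have h : (fun i => lastWeight n (idxEquiv n (Sum.inl i))) = 1 := by
      ext1 i
      simp [lastWeight, idxEquiv]
    rw [h]
    exact hp
  have h2 (x : Pol n) : IsWeightedHomogeneous (lastWeight n) (oldVars n x) 0 := by
    refine isWeightedHomogeneous_rename _ _ _ _ ?_
    have h : (fun i => lastWeight n (idxEquiv n (Sum.inr i))) = 0 := by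
      ext1 i
      simp [lastWeight, idxEquiv, i.2.2.ne]
    rw [h]
    intro d _
    simp [Finsupp.weight_apply]
  rw [Submodule.mul_le]
  rintro _ ⟨p, hp, rfl⟩ _ ⟨x, -, rfl⟩
  exact (h1 p hp).mul (h2 x)

theorem component_eq {n : ℕ} (k : Fin (n + 1) → ℕ) (r : ℕ) :
    component (n + 1) k r = Submodule.span ℂ (Sdeg (n + 1) k r) := by
  rw [component, V_eq_blockSpan, ← span_S_eq_blockSpan]
  apply le_antisymm
  -- the homogeneous component of degree `r` in the last row kills the products of other degrees
  · rintro f ⟨hf, hfr⟩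
    have h : ∀ g ∈ Submodule.span ℂ (S (n + 1) k),
        weightedHomogeneousComponent (lastWeight n) r g ∈
          Submodule.span ℂ (Sdeg (n + 1) k r) := by
      intro g hg
      induction hg using Submodule.span_induction with
      | mem g hg =>
        obtain ⟨α, hα, rfl⟩ := hg
        have h1 := isWeightedHomogeneous_of_mem_hatComponent k _ _
          (minorProd_mem_hatComponent k α hα)
        rw [weightedHomogeneousComponent_of_mem h1]
        split_ifs with h2
        · exact Submodule.subset_span ⟨α, hα, h2.symm, rfl⟩
        · exact Submodule.zero_mem _
      | zero => simp
      | add g h _ _ hg hh => rw [map_add]; exact add_mem hg hh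
      | smul c g _ hg => rw [map_smul]; exact Submodule.smul_mem _ c hg
    have := h f hf
    rwa [(isWeightedHomogeneous_of_mem_hatComponent k r f hfr).weightedHomogeneousComponent_same]
      at this
  · rw [Submodule.span_le]
    rintro _ ⟨α, hα, rfl, rfl⟩
    exact ⟨Submodule.subset_span ⟨α, hα, rfl⟩, minorProd_mem_hatComponent k α hα⟩

theorem component_eq_bot {n : ℕ} (k : Fin (n + 1) → ℕ) (r : ℕ) (hr : ∑ i, k i < r) :
    component (n + 1) k r = ⊥ := by
  have : Sdeg (n + 1) k r = ∅ := by
    rw [Set.eq_empty_iff_forall_notMem]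
    rintro _ ⟨α, hα, h, -⟩
    have := lastDegree_le k α hα
    omega
  rw [component_eq, this, Submodule.span_empty]

end

end SLRealization

theorem theorem2p4 (n : ℕ) (hn : 2 ≤ n) (k : Fin n → ℕ) :
    SLRealization.IsIrreducibleSubmodule k (SLRealization.V n k) ∧
    (∃ v ∈ SLRealization.V n k, SLRealization.IsHighestWeightVector k v) ∧
    SLRealization.V n k = Submodule.span ℂ (SLRealization.S n k) ∧
    (∀ r : ℕ, SLRealization.component n k r = Submodule.span ℂ (SLRealization.Sdeg n k r)) ∧
    (∀ r : ℕ, (∑ i, k i) < r → SLRealization.component n k r = ⊥) := by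
  obtain ⟨n, rfl⟩ : ∃ m, n = m + 1 := ⟨n - 1, by omega⟩
  rw [SLRealization.span_S_eq_blockSpan, SLRealization.V_eq_blockSpan]
  exact ⟨SLRealization.isIrreducibleSubmodule_blockSpan k,
    ⟨1, SLRealization.one_mem_blockSpan k, SLRealization.isHighestWeightVector_one k⟩, rfl,
    SLRealization.component_eq k, SLRealization.component_eq_bot k⟩
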